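/- **Conventions.** Let $n,k\in\mathbb{N}_0$. $\langle\cdot,\cdot\rangle$ is the bilinear bracket between $\mathcal S'$ and $\mathcal S$, and $\mathcal S\subset\mathcal S'$ via $\langle\psi,\phi\rangle=\int\psi\phi$. An operator $A:\mathcal S(\mathbb R^n)\to\mathcal S'(\mathbb R^n)$ has Weyl symbol $a\in\mathcal S'(\mathbb R^{2n})$ if $\langle A\psi,\phi\rangle=\langle a,W(\psi,\overline{\phi})\rangle$ for all $\psi,\phi\in\mathcal S(\mathbb R^n)$, where $$W(\psi,\overline\phi)(x,\xi)=(2\pi)^{-n}\int_{\mathbb R^n}e^{-i\xi\cdot y}\,\psi(x+\tfrac12y)\,\phi(x-\tfrac12y)\,dy$$ (formally $A\psi(x)=(2\pi)^{-n}\iint e^{i(x-y)\cdot\xi}a(\tfrac12(x+y),\xi)\psi(y)\,dy\,d\xi$). $\mathrm{Sp}(2N,\mathbb R)$ is the group of linear automorphisms of $\mathbb R^{2N}=\mathbb R^N_x\times\mathbb R^N_\xi$ preserving $\sigma((x,\xi),(x',\xi'))=\xi\cdot x'-\xi'\cdot x$. For $s\in\mathrm{Sp}(2(n+k),\mathbb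 R)$, $\mathbb E_s[A]:\mathcal S(\mathbb R^{n+k})\to\mathcal S'(\mathbb R^{n+k})$ is the operator with Weyl symbol $(a\otimes1)\circ s$, where $(a\otimes 1)(x,y;\xi,\eta)=a(x,\xi)$ for $(x,\xi)\in\mathbb R^{2n}$, $(y,\eta)\in\mathbb R^{2k}$; that is, $\langle (a\otimes1)\circ s,\Phi\rangle=\langle a,\ (x,\xi)\mapsto\iint\Phi(s^{-1}(x,y;\xi,\eta))\,dy\,d\eta\rangle$. The metaplectic group and its projection onto $\mathrm{Sp}(2N,\mathbb R)$ are generated by the pairs $(S_{W,m},s_W)$, where $W(x,x')=\frac12Px\cdot x-Lx\cdot x'+\frac12Qx'\cdot x'$ with $P,Q$ symmetric and $\det L\ne0$, $m\in\mathbb Z$ with $\det L=(-1)^m|\det L|$, $$S_{W,m}f(x)=\left(\tfrac1{2\pi i}\right)^{N/2}i^m\sqrt{|\det L|}\int_{\mathbb R^N}e^{iW(x,x')}f(x')\,dx',$$ and $(x,\xi)=s_W(x',\xi')$ if and only if $\xi=\partial_xW(x,x')$ and $\xi'=-\partial_{x'}W(x,x')$. "Associated with $s$" means projecting onto $s$.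 Metaplectic operators map $\mathcal S(\mathbb R^N)$ bijectively onto itself. For a metaplectic operator $\widetilde S$ on $\mathbb R^{n+k}$ and $\chi\in\mathcal S(\mathbb R^k)$ put $$T_{\widetilde S,\chi}\psi=\widetilde S^{-1}(\psi\otimes\chi),\qquad T^*_{\widetilde S,\chi}\Psi(x)=\int_{\mathbb R^k}\overline{\chi(y)}\,(\widetilde S\Psi)(x,y)\,dy$$ for $\psi\in\mathcal S(\mathbb R^n)$, $\Psi\in\mathcal S(\mathbb R^{n+k})$. An eigenfunction of $B:\mathcal S(\mathbb R^N)\to\mathcal S'(\mathbb R^N)$ for the eigenvalue $\lambda\in\mathbb C$ is a nonzero $\psi\in\mathcal S(\mathbb R^N)$ with $B\psi=\lambda\psi$ in $\mathcal S'(\mathbb R^N)$. **Proposition.** Let $A:\mathcal S(\mathbb R^n)\to\mathcal S'(\mathbb R^n)$ be a continuous linear operator with Weyl symbol $a\in\mathcal S'(\mathbb R^{2n})$, let $s\in\mathrm{Sp}(2(n+k),\mathbb R)$ and $\widetilde A_s=\mathbb E_s[A]$. Then: (i) $A$ and $\widetilde A_s$ have the same eigenvalues. Moreover, for every metaplectic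 operator $\widetilde S$ associated with $s$: (ii) If $\psi$ is an eigenfunction of $A$ for the eigenvalue $\lambda$, then for every $\chi\in\mathcal S(\mathbb R^k)\setminus\{0\}$ the function $T_{\widetilde S,\chi}\psi\in\mathcal S(\mathbb R^{n+k})$ is an eigenfunction of $\widetilde A_s$ for $\lambda$. (iii) If $\Psi$ is an eigenfunction of $\widetilde A_s$ for the eigenvalue $\lambda$, $\chi\in\mathcal S(\mathbb R^k)$ and $T^*_{\widetilde S,\chi}\Psi\neq0$, then $T^*_{\widetilde S,\chi}\Psi$ is an eigenfunction of $A$ for $\lambda$. (iv) If $(\psi_j)_j$ is an orthonormal basis of $L^2(\mathbb R^n)$ consisting of eigenfunctions of $A$ with eigenvalues $\lambda_j$, and $(\chi_l)_l$ is an orthonormal basis of $L^2(\mathbb R^k)$ with $\chi_l\in\mathcal S(\mathbb R^k)$, then $(T_{\widetilde S,\chi_l}\psi_j)_{j,l}$ is an orthonormal basis of $L^2(\mathbb R^{n+k})$, and each $T_{\widetilde S,\chi_l}\psi_j$ is an eigenfunction of $\widetilde A_s$ for $\lambda_j$. -/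

import Mathlib

open SchwartzMap MeasureTheory
open scoped FourierTransform ContDiff

set_option linter.unusedSectionVars false

namespace SymplecticExtension

noncomputable section

section PartialFourier

variable {E F V : Type} [NormedAddCommGroup E] [NormedSpace ℝ E]
  [NormedAddCommGroup F] [InnerProductSpace ℝ F] [FiniteDimensional ℝ F]
  [MeasurableSpace F] [BorelSpace F]
  [NormedAddCommGroup V] [NormedSpace ℝ V] [NormedSpace ℂ V] [IsScalarTower ℝ ℂ V]

/-- The partial Fourier integral `(x, η) ↦ ∫ e^{-i η·y} Φ(x, y) dy`. -/
def partialFourierFun (Φ : E × F → V) (z : E × F) : V :=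
  ∫ y : F, Complex.exp (-(Complex.I * (inner ℝ z.2 y : ℝ))) • Φ (z.1, y)

lemma hasTemperateGrowth_mk (x : E) : Function.HasTemperateGrowth fun y : F ↦ (x, y) := by
  have h : (fun y : F ↦ (x, y)) =
      (fun _ : F ↦ ((x, 0) : E × F)) + (ContinuousLinearMap.inr ℝ E F : F → E × F) := by
    ext y <;> simp
  rw [h]
  exact (Function.HasTemperateGrowth.const _).add
    (ContinuousLinearMap.inr ℝ E F).hasTemperateGrowth

/-- The slice `y ↦ Φ(x, y)` of a Schwartz function. -/
def slice (x : E) : 𝓢(E × F, V) →L[ℂ] 𝓢(F, V) :=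
  SchwartzMap.compCLM ℂ (g := fun y : F ↦ (x, y)) (hasTemperateGrowth_mk x)
    ⟨1, 1, fun y ↦ by
      have : ‖y‖ ≤ ‖(x, y)‖ := le_max_right _ _
      linarith⟩

lemma slice_apply (x : E) (Φ : 𝓢(E × F, V)) (y : F) : slice x Φ y = Φ (x, y) := rfl

lemma norm_iteratedFDeriv_slice_le (x : E) (Φ : 𝓢(E × F, V)) (q : ℕ) (y : F) :
    ‖iteratedFDeriv ℝ q (slice x Φ) y‖ ≤ ‖iteratedFDeriv ℝ q Φ (x, y)‖ := by
  have e : (slice x Φ : F → V) =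
      (fun z ↦ Φ ((x, 0) + z)) ∘ (ContinuousLinearMap.inr ℝ E F) := by
    ext y; simp [slice_apply]
  have hc : ContDiff ℝ q (fun z ↦ Φ ((x, 0) + z)) :=
    (Φ.smooth q).comp (contDiff_const.add contDiff_id)
  rw [e, ContinuousLinearMap.iteratedFDeriv_comp_right _ hc _ le_rfl]
  refine (ContinuousMultilinearMap.norm_compContinuousLinearMap_le _ _).trans ?_
  rw [iteratedFDeriv_comp_add_left]
  simp only [ContinuousLinearMap.inr_apply, Prod.mk_add_mk, add_zero, zero_add]
  refine mul_le_of_le_one_right (norm_nonneg _) ?_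
  exact Finset.prod_le_one (fun _ _ ↦ norm_nonneg _)
    (fun _ _ ↦ ContinuousLinearMap.norm_inr_le_one ℝ E F)

lemma seminorm_slice_le (x : E) (Φ : 𝓢(E × F, V)) (k p q : ℕ) :
    ‖x‖ ^ k * SchwartzMap.seminorm ℂ p q (slice x Φ) ≤ SchwartzMap.seminorm ℂ (k + p) q Φ := by
  have h0 : 0 ≤ SchwartzMap.seminorm ℂ (k + p) q Φ := apply_nonneg _ _
  have key : ∀ y, ‖x‖ ^ k * (‖y‖ ^ p * ‖iteratedFDeriv ℝ q (slice x Φ) y‖) ≤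
      SchwartzMap.seminorm ℂ (k + p) q Φ := by
    intro y
    refine le_trans ?_ (SchwartzMap.le_seminorm ℂ (k + p) q Φ (x, y))
    have h1 : ‖y‖ ≤ ‖(x, y)‖ := le_max_right _ _
    have h2 : ‖x‖ ≤ ‖(x, y)‖ := le_max_left _ _
    rw [pow_add, mul_assoc]
    have h3 := norm_iteratedFDeriv_slice_le x Φ q y
    gcongr
  rcases (pow_nonneg (norm_nonneg x) k).eq_or_lt with h | h
  · rw [← h, zero_mul]; exact h0
  · rw [← le_div_iff₀' h]
    refine SchwartzMap.seminorm_le_bound ℂ p q _ (by positivity) fun y ↦ ?_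
    rw [le_div_iff₀' h]
    exact key y

/-- Precomposition with a real linear map, as a complex linear map. -/
def precompC (P : E →L[ℝ] E) : (E →L[ℝ] V) →L[ℂ] (E →L[ℝ] V) :=
  LinearMap.mkContinuous
    { toFun := fun T ↦ T.comp P
      map_add' := fun _ _ ↦ by ext; simp
      map_smul' := fun _ _ ↦ by ext; simp } ‖P‖
    (fun T ↦ by rw [mul_comm]; exact T.opNorm_comp_le P)

/-- The derivative of the integrand of the partial Fourier integral, as a Schwartz function. -/
def partialFourierDeriv : 𝓢(E × F, V) →L[ℂ] 𝓢(E × F, E × F →L[ℝ] V) :=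
  (SchwartzMap.postcompCLM
    (precompC ((ContinuousLinearMap.inl ℝ E F).comp (ContinuousLinearMap.fst ℝ E F)))) ∘L
    SchwartzMap.fderivCLM ℂ (E × F) V -
  Complex.I • SchwartzMap.smulRightCLM ℂ V
    ((((innerSL ℝ).comp (ContinuousLinearMap.snd ℝ E F)).flip.comp
      (ContinuousLinearMap.snd ℝ E F)).flip)

lemma partialFourierDeriv_apply (Φ : 𝓢(E × F, V)) (z v : E × F) :
    partialFourierDeriv Φ z v = fderiv ℝ Φ z (v.1, 0) -
      Complex.I • (inner ℝ v.2 z.2 : ℝ) • Φ z := by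
  simp [partialFourierDeriv, precompC, real_inner_comm]

lemma norm_slice_le (Φ : 𝓢(E × F, V)) (r : ℕ) :
    ∃ C : ℝ, ∀ z : E × F, ‖Φ z‖ ≤ C * (1 + ‖z.2‖) ^ (-(r : ℝ)) := by
  refine ⟨2 ^ r * ((Finset.Iic (r, 0)).sup (fun m => SchwartzMap.seminorm ℂ m.1 m.2) Φ),
    fun z ↦ ?_⟩
  have h := SchwartzMap.one_add_le_sup_seminorm_apply (𝕜 := ℂ) (m := (r, 0)) (k := r) (n := 0)
    le_rfl le_rfl Φ z
  rw [norm_iteratedFDeriv_zero] at h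
  rw [Real.rpow_neg (by positivity), Real.rpow_natCast, ← div_eq_mul_inv,
    le_div_iff₀' (by positivity)]
  refine le_trans ?_ h
  have : ‖z.2‖ ≤ ‖z‖ := le_max_right _ _
  gcongr

lemma norm_kernel (η y : F) : ‖Complex.exp (-(Complex.I * (inner ℝ η y : ℝ)))‖ = 1 := by
  rw [Complex.norm_exp]
  simp

lemma continuous_integrand (Φ : 𝓢(E × F, V)) (z : E × F) :
    Continuous fun y : F ↦
      Complex.exp (-(Complex.I * (inner ℝ z.2 y : ℝ))) • Φ (z.1, y) := by
  have := Φ.continuous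
  fun_prop

lemma integrable_integrand (Φ : 𝓢(E × F, V)) (z : E × F) :
    Integrable fun y : F ↦
      Complex.exp (-(Complex.I * (inner ℝ z.2 y : ℝ))) • Φ (z.1, y) := by
  refine ((slice z.1 Φ).integrable (μ := volume)).norm.mono'
    (continuous_integrand Φ z).aestronglyMeasurable (Filter.Eventually.of_forall fun y ↦ ?_)
  rw [norm_smul, norm_kernel, one_mul, slice_apply]

lemma hasFDerivAt_kernel (z : E × F) (y : F) :
    HasFDerivAt (fun z : E × F ↦ -(Complex.I * (inner ℝ z.2 y : ℝ)))
      (-(Complex.I • (Complex.ofRealCLM.comp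
        ((innerSL ℝ y).comp (ContinuousLinearMap.snd ℝ E F))))) z := by
  have h3 : (fun z : E × F ↦ -(Complex.I * (inner ℝ z.2 y : ℝ))) =
      (-(Complex.I • (Complex.ofRealCLM.comp
      ((innerSL ℝ y).comp (ContinuousLinearMap.snd ℝ E F)))) : E × F →L[ℝ] ℂ) := by
    ext z; simp [real_inner_comm]
  rw [h3]
  exact ContinuousLinearMap.hasFDerivAt _

lemma hasFDerivAt_shift (Φ : 𝓢(E × F, V)) (z : E × F) (y : F) :
    HasFDerivAt (fun z : E × F ↦ Φ (z.1, y))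
      ((fderiv ℝ Φ (z.1, y)).comp
        ((ContinuousLinearMap.inl ℝ E F).comp (ContinuousLinearMap.fst ℝ E F))) z := by
  have hg : HasFDerivAt (fun z : E × F ↦ (z.1, y))
      ((ContinuousLinearMap.inl ℝ E F).comp (ContinuousLinearMap.fst ℝ E F)) z := by
    have h := (hasFDerivAt_fst (𝕜 := ℝ) (p := z)).prodMk (hasFDerivAt_const y z)
    have e : (ContinuousLinearMap.inl ℝ E F).comp (ContinuousLinearMap.fst ℝ E F) =
        (ContinuousLinearMap.fst ℝ E F).prod (0 : E × F →L[ℝ] F) := by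
      ext v <;> simp
    rw [e]
    exact h
  exact (Φ.hasFDerivAt (z.1, y)).comp z hg

lemma hasFDerivAt_integrand (Φ : 𝓢(E × F, V)) (z : E × F) (y : F) :
    HasFDerivAt (fun z : E × F ↦
        Complex.exp (-(Complex.I * (inner ℝ z.2 y : ℝ))) • Φ (z.1, y))
      (Complex.exp (-(Complex.I * (inner ℝ z.2 y : ℝ))) • partialFourierDeriv Φ (z.1, y)) z := by
  have h4 := (hasFDerivAt_kernel z y).cexp.smul (hasFDerivAt_shift Φ z y)
  refine h4.congr_fderiv ?_
  refine ContinuousLinearMap.ext fun v ↦ ?_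
  rw [smul_apply, partialFourierDeriv_apply]
  simp [sub_eq_add_neg, mul_smul, real_inner_comm]
  exact algebraMap_smul ℂ (inner ℝ y v.2) (Φ (z.1, y))


lemma norm_integrand (Φ : 𝓢(E × F, V)) (z : E × F) (y : F) :
    ‖Complex.exp (-(Complex.I * (inner ℝ z.2 y : ℝ))) • Φ (z.1, y)‖ = ‖Φ (z.1, y)‖ := by
  rw [norm_smul, norm_kernel, one_mul]

set_option maxHeartbeats 1000000 in

lemma hasFDerivAt_partialFourierFun (Φ : 𝓢(E × F, V)) (z : E × F) :
    HasFDerivAt (partialFourierFun Φ) (partialFourierFun (partialFourierDeriv Φ) z) z := by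
  obtain ⟨r, hr⟩ := (inferInstance : (volume : Measure F).HasTemperateGrowth).exists_integrable
  obtain ⟨C, hC⟩ := norm_slice_le (partialFourierDeriv Φ) r
  refine hasFDerivAt_integral_of_dominated_of_fderiv_le (s := Set.univ) (μ := volume)
    (F := fun (z : E × F) (y : F) ↦
      Complex.exp (-(Complex.I * (inner ℝ z.2 y : ℝ))) • Φ (z.1, y))
    (F' := fun z y ↦ Complex.exp (-(Complex.I * (inner ℝ z.2 y : ℝ))) •
      partialFourierDeriv Φ (z.1, y))
    (bound := fun y ↦ C * (1 + ‖y‖) ^ (-(r : ℝ))) Filter.univ_mem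
    (Filter.Eventually.of_forall fun z ↦ (continuous_integrand Φ z).aestronglyMeasurable)
    (integrable_integrand Φ z) (continuous_integrand _ z).aestronglyMeasurable
    (Filter.Eventually.of_forall fun y z _ ↦ ?_) (hr.const_mul C)
    (Filter.Eventually.of_forall fun y z _ ↦ hasFDerivAt_integrand Φ z y)
  exact (norm_integrand _ z y).trans_le (hC (z.1, y))

lemma fderiv_partialFourierFun (Φ : 𝓢(E × F, V)) :
    fderiv ℝ (partialFourierFun Φ) = partialFourierFun (partialFourierDeriv Φ) :=
  funext fun z ↦ (hasFDerivAt_partialFourierFun Φ z).fderiv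

end PartialFourier

section Bounds

variable {E F : Type} [NormedAddCommGroup E] [NormedSpace ℝ E]
  [NormedAddCommGroup F] [InnerProductSpace ℝ F] [FiniteDimensional ℝ F]
  [MeasurableSpace F] [BorelSpace F]

lemma contDiff_partialFourierFun_nat (n : ℕ) :
    ∀ {V : Type} [NormedAddCommGroup V] [NormedSpace ℝ V] [NormedSpace ℂ V] [IsScalarTower ℝ ℂ V] (Φ : 𝓢(E × F, V)),
      ContDiff ℝ n (partialFourierFun Φ) := by
  induction n with
  | zero =>
    intro V _ _ _ _ Φ
    exact contDiff_zero.2 (continuous_iff_continuousAt.2 fun z ↦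
      (hasFDerivAt_partialFourierFun Φ z).continuousAt)
  | succ n ih =>
    intro V _ _ _ _ Φ
    rw [Nat.cast_succ, contDiff_succ_iff_fderiv]
    refine ⟨fun z ↦ (hasFDerivAt_partialFourierFun Φ z).differentiableAt,
      fun h ↦ absurd h (by simp), ?_⟩
    rw [fderiv_partialFourierFun]
    exact ih _

lemma partialFourierFun_eq {V : Type} [NormedAddCommGroup V] [NormedSpace ℂ V]
    (Φ : 𝓢(E × F, V)) (z : E × F) :
    partialFourierFun Φ z = 𝓕 (slice z.1 Φ) ((2 * Real.pi)⁻¹ • z.2) := by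
  rw [SchwartzMap.fourier_coe, Real.fourier_eq', partialFourierFun]
  congr 1
  ext y
  rw [slice_apply]
  congr 2
  rw [real_inner_smul_right, real_inner_comm]
  push_cast
  have : (Real.pi : ℂ) ≠ 0 := by exact_mod_cast Real.pi_ne_zero
  field_simp

lemma partialFourierFun_decay_aux {V : Type} [NormedAddCommGroup V] [NormedSpace ℂ V] (k l : ℕ) :
    ∃ q : Seminorm ℂ 𝓢(E × F, V), Continuous q ∧
      ∀ (Φ : 𝓢(E × F, V)) (z : E × F),
        ‖z.1‖ ^ k * (‖z.2‖ ^ l * ‖partialFourierFun Φ z‖) ≤ q Φ := by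
  have hcont : Continuous ((SchwartzMap.seminorm ℂ l 0).comp
      (SchwartzMap.fourierTransformCLM ℂ (E := V) (V := F)).toLinearMap) :=
    ((schwartz_withSeminorms ℂ F V).continuous_seminorm (l, 0)).comp
      (SchwartzMap.fourierTransformCLM ℂ (E := V) (V := F)).continuous
  obtain ⟨s, C, -, hC⟩ :=
    Seminorm.bound_of_continuous (schwartz_withSeminorms ℂ F V) _ hcont
  have hsum : Continuous (∑ i ∈ s, SchwartzMap.seminorm ℂ (k + i.1) i.2 :
      Seminorm ℂ 𝓢(E × F, V)) := by
    refine Finset.sum_induction _ (fun q : Seminorm ℂ 𝓢(E × F, V) ↦ Continuous q)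
      (fun _ _ ha hb ↦ ha.add hb) continuous_const fun i _ ↦
        (schwartz_withSeminorms ℂ (E × F) V).continuous_seminorm (k + i.1, i.2)
  refine ⟨((2 * Real.pi).toNNReal ^ l * C) •
    ∑ i ∈ s, SchwartzMap.seminorm ℂ (k + i.1) i.2, hsum.const_smul _, fun Φ z ↦ ?_⟩
  have hpi : 0 < 2 * Real.pi := by positivity
  set w : F := (2 * Real.pi)⁻¹ • z.2 with hw
  have hz : ‖z.2‖ = 2 * Real.pi * ‖w‖ := by
    rw [hw, norm_smul, norm_inv, Real.norm_of_nonneg hpi.le, mul_inv_cancel_left₀ hpi.ne']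
  have h1 : ‖w‖ ^ l * ‖𝓕 (slice z.1 Φ) w‖ ≤
      C * ∑ i ∈ s, SchwartzMap.seminorm ℂ i.1 i.2 (slice z.1 Φ) := by
    have e1 := SchwartzMap.le_seminorm ℂ l 0 (𝓕 (slice z.1 Φ)) w
    rw [norm_iteratedFDeriv_zero] at e1
    refine e1.trans ((hC (slice z.1 Φ)).trans ?_)
    have e2 := Seminorm.finset_sup_le_sum (schwartzSeminormFamily ℂ F V) s (slice z.1 Φ)
    rw [sum_apply] at e2
    exact mul_le_mul_of_nonneg_left e2 C.2
  have h2 : ‖z.1‖ ^ k * ∑ i ∈ s, SchwartzMap.seminorm ℂ i.1 i.2 (slice z.1 Φ) ≤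
      ∑ i ∈ s, SchwartzMap.seminorm ℂ (k + i.1) i.2 Φ := by
    rw [Finset.mul_sum]
    exact Finset.sum_le_sum fun i _ ↦ seminorm_slice_le z.1 Φ k i.1 i.2
  rw [partialFourierFun_eq, ← hw, hz, smul_apply, sum_apply, NNReal.smul_def,
    smul_eq_mul, NNReal.coe_mul, NNReal.coe_pow, Real.coe_toNNReal _ hpi.le]
  calc _ = (2 * Real.pi) ^ l * (‖z.1‖ ^ k * (‖w‖ ^ l * ‖𝓕 (slice z.1 Φ) w‖)) := by ring
    _ ≤ (2 * Real.pi) ^ l * (‖z.1‖ ^ k *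
        (C * ∑ i ∈ s, SchwartzMap.seminorm ℂ i.1 i.2 (slice z.1 Φ))) := by gcongr
    _ = (2 * Real.pi) ^ l * (C * (‖z.1‖ ^ k *
        ∑ i ∈ s, SchwartzMap.seminorm ℂ i.1 i.2 (slice z.1 Φ))) := by ring
    _ ≤ (2 * Real.pi) ^ l * (C * ∑ i ∈ s, SchwartzMap.seminorm ℂ (k + i.1) i.2 Φ) := by gcongr
    _ = _ := by ring

lemma partialFourierFun_decay {V : Type} [NormedAddCommGroup V] [hR : NormedSpace ℝ V]
    [NormedSpace ℂ V] [IsScalarTower ℝ ℂ V] (k l : ℕ) :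
    ∃ q : Seminorm ℂ 𝓢(E × F, V), Continuous q ∧
      ∀ (Φ : 𝓢(E × F, V)) (z : E × F),
        ‖z.1‖ ^ k * (‖z.2‖ ^ l * ‖partialFourierFun Φ z‖) ≤ q Φ := by
  have h : hR = NormedSpace.complexToReal := by
    ext r v
    exact (algebraMap_smul ℂ r v).symm
  subst h
  exact partialFourierFun_decay_aux k l

lemma partialFourierFun_bound (n : ℕ) :
    ∀ {V : Type} [NormedAddCommGroup V] [NormedSpace ℝ V] [NormedSpace ℂ V] [IsScalarTower ℝ ℂ V] (k : ℕ),
      ∃ q : Seminorm ℂ 𝓢(E × F, V), Continuous q ∧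
        ∀ (Φ : 𝓢(E × F, V)) (z : E × F),
          ‖z‖ ^ k * ‖iteratedFDeriv ℝ n (partialFourierFun Φ) z‖ ≤ q Φ := by
  induction n with
  | zero =>
    intro V _ _ _ _ k
    obtain ⟨q₁, h₁, b₁⟩ := partialFourierFun_decay (E := E) (F := F) (V := V) k 0
    obtain ⟨q₂, h₂, b₂⟩ := partialFourierFun_decay (E := E) (F := F) (V := V) 0 k
    refine ⟨q₁ + q₂, h₁.add h₂, fun Φ z ↦ ?_⟩
    rw [norm_iteratedFDeriv_zero]
    have e₁ := b₁ Φ z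
    have e₂ := b₂ Φ z
    simp only [pow_zero, one_mul] at e₁ e₂
    have h : ‖z‖ ^ k ≤ ‖z.1‖ ^ k + ‖z.2‖ ^ k := by
      rw [Prod.norm_def]
      rcases max_choice ‖z.1‖ ‖z.2‖ with h | h <;> rw [h]
      · exact le_add_of_nonneg_right (by positivity)
      · exact le_add_of_nonneg_left (by positivity)
    calc _ ≤ (‖z.1‖ ^ k + ‖z.2‖ ^ k) * ‖partialFourierFun Φ z‖ := by gcongr
      _ ≤ _ := by rw [add_mul]; exact add_le_add e₁ e₂
  | succ n ih =>
    intro V _ _ _ _ k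
    obtain ⟨q, hq, b⟩ := ih (V := E × F →L[ℝ] V) k
    have hc : Continuous (q.comp (partialFourierDeriv (E := E) (F := F) (V := V)).toLinearMap) :=
      hq.comp (partialFourierDeriv (E := E) (F := F) (V := V)).continuous
    refine ⟨q.comp (partialFourierDeriv (E := E) (F := F) (V := V)).toLinearMap, hc,
      fun Φ z ↦ ?_⟩
    rw [← norm_iteratedFDeriv_fderiv, fderiv_partialFourierFun]
    exact b _ z

variable {V : Type} [NormedAddCommGroup V] [NormedSpace ℝ V] [NormedSpace ℂ V] [IsScalarTower ℝ ℂ V]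

/-- The partial Fourier transform in the second variable on Schwartz functions. -/
def partialFourier : 𝓢(E × F, V) →L[ℂ] 𝓢(E × F, V) :=
  SchwartzMap.mkCLM (fun Φ ↦ partialFourierFun Φ)
    (fun Φ Ψ z ↦ by
      simp only [partialFourierFun, add_apply, smul_add]
      exact integral_add (integrable_integrand Φ z) (integrable_integrand Ψ z))
    (fun c Φ z ↦ by
      simp only [partialFourierFun, smul_apply, RingHom.id_apply]
      rw [← integral_smul]
      simp only [smul_comm c])
    (fun Φ ↦ contDiff_infty.2 fun n ↦ contDiff_partialFourierFun_nat n Φ)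
    (fun m ↦ by
      obtain ⟨q, hq, b⟩ := partialFourierFun_bound (E := E) (F := F) m.2 (V := V) m.1
      obtain ⟨s, C, -, hC⟩ :=
        Seminorm.bound_of_continuous (schwartz_withSeminorms ℂ (E × F) V) q hq
      exact ⟨s, C, C.2, fun Φ z ↦ (b Φ z).trans (hC Φ)⟩)

lemma partialFourier_apply (Φ : 𝓢(E × F, V)) (x : E) (η : F) :
    partialFourier Φ (x, η) =
      ∫ y : F, Complex.exp (-(Complex.I * (inner ℝ η y : ℝ))) • Φ (x, y) := rfl


/-- Integration over the second variable, `(∫_F Φ)(x) = ∫ Φ(x, y) dy`, on Schwartz functions: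
the value of the partial Fourier transform at the frequency `η = 0`. -/
def partialIntegral : 𝓢(E × F, V) →L[ℂ] 𝓢(E, V) :=
  (SchwartzMap.compCLM ℂ (g := fun x : E ↦ (x, (0 : F)))
    (ContinuousLinearMap.inl ℝ E F).hasTemperateGrowth
    ⟨1, 1, fun x ↦ by
      have : ‖x‖ ≤ ‖(x, (0 : F))‖ := le_max_left _ _
      linarith⟩) ∘L partialFourier

lemma partialIntegral_apply (Φ : 𝓢(E × F, V)) (x : E) :
    partialIntegral Φ x = ∫ y : F, Φ (x, y) := by
  change partialFourier Φ (x, (0 : F)) = _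
  rw [partialFourier_apply]
  simp

end Bounds

section Tensor

variable {E F : Type} [NormedAddCommGroup E] [NormedSpace ℝ E]
  [NormedAddCommGroup F] [NormedSpace ℝ F]

lemma norm_iteratedFDeriv_comp_fst_le (ψ : 𝓢(E, ℂ)) (i : ℕ) (z : E × F) :
    ‖iteratedFDeriv ℝ i (fun z : E × F ↦ ψ z.1) z‖ ≤ ‖iteratedFDeriv ℝ i ψ z.1‖ := by
  change ‖iteratedFDeriv ℝ i (ψ ∘ ContinuousLinearMap.fst ℝ E F) z‖ ≤ _
  rw [ContinuousLinearMap.iteratedFDeriv_comp_right _ (ψ.smooth i) _ le_rfl]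
  refine (ContinuousMultilinearMap.norm_compContinuousLinearMap_le _ _).trans ?_
  exact mul_le_of_le_one_right (norm_nonneg _) (Finset.prod_le_one (fun _ _ ↦ norm_nonneg _)
    (fun _ _ ↦ ContinuousLinearMap.norm_fst_le ℝ E F))

lemma norm_iteratedFDeriv_comp_snd_le (χ : 𝓢(F, ℂ)) (i : ℕ) (z : E × F) :
    ‖iteratedFDeriv ℝ i (fun z : E × F ↦ χ z.2) z‖ ≤ ‖iteratedFDeriv ℝ i χ z.2‖ := by
  change ‖iteratedFDeriv ℝ i (χ ∘ ContinuousLinearMap.snd ℝ E F) z‖ ≤ _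
  rw [ContinuousLinearMap.iteratedFDeriv_comp_right _ (χ.smooth i) _ le_rfl]
  refine (ContinuousMultilinearMap.norm_compContinuousLinearMap_le _ _).trans ?_
  exact mul_le_of_le_one_right (norm_nonneg _) (Finset.prod_le_one (fun _ _ ↦ norm_nonneg _)
    (fun _ _ ↦ ContinuousLinearMap.norm_snd_le ℝ E F))

lemma contDiff_comp_fst (ψ : 𝓢(E, ℂ)) (n : ℕ∞) :
    ContDiff ℝ n (fun z : E × F ↦ ψ z.1) := (ψ.smooth n).comp contDiff_fst

lemma contDiff_comp_snd (χ : 𝓢(F, ℂ)) (n : ℕ∞) :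
    ContDiff ℝ n (fun z : E × F ↦ χ z.2) := (χ.smooth n).comp contDiff_snd

lemma tensor_bound (χ : 𝓢(F, ℂ)) (m : ℕ × ℕ) :
    ∃ (s : Finset (ℕ × ℕ)) (C : ℝ), 0 ≤ C ∧ ∀ (ψ : 𝓢(E, ℂ)) (z : E × F),
      ‖z‖ ^ m.1 * ‖iteratedFDeriv ℝ m.2 (fun z : E × F ↦ ψ z.1 * χ z.2) z‖ ≤
        C * s.sup (schwartzSeminormFamily ℂ E ℂ) ψ := by
  obtain ⟨k, n⟩ := m
  refine ⟨Finset.Iic (k, n), ∑ i ∈ Finset.range (n + 1), (n.choose i : ℝ) *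
    (SchwartzMap.seminorm ℂ 0 (n - i) χ + SchwartzMap.seminorm ℂ k (n - i) χ),
    Finset.sum_nonneg fun i _ ↦ mul_nonneg (by positivity)
      (add_nonneg (apply_nonneg _ _) (apply_nonneg _ _)), fun ψ z ↦ ?_⟩
  set M := (Finset.Iic (k, n)).sup (schwartzSeminormFamily ℂ E ℂ) ψ
  have hM : ∀ a b, a ≤ k → b ≤ n → SchwartzMap.seminorm ℂ a b ψ ≤ M := by
    intro a b ha hb
    exact Seminorm.le_def.1 (Finset.le_sup (f := schwartzSeminormFamily ℂ E ℂ)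
      (Finset.mem_Iic.2 (Prod.mk_le_mk.2 ⟨ha, hb⟩))) ψ
  have hz : ‖z‖ ^ k ≤ ‖z.1‖ ^ k + ‖z.2‖ ^ k := by
    rw [Prod.norm_def]
    rcases max_choice ‖z.1‖ ‖z.2‖ with h | h <;> rw [h]
    · exact le_add_of_nonneg_right (by positivity)
    · exact le_add_of_nonneg_left (by positivity)
  have hmul := norm_iteratedFDeriv_mul_le (contDiff_comp_fst (F := F) ψ n)
    (contDiff_comp_snd (E := E) χ n) z (n := n) le_rfl
  refine (mul_le_mul_of_nonneg_left hmul (by positivity)).trans ?_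
  rw [Finset.mul_sum, Finset.sum_mul]
  refine Finset.sum_le_sum fun i hi ↦ ?_
  have hi' : i ≤ n := Nat.lt_succ_iff.1 (Finset.mem_range.1 hi)
  have a0 := SchwartzMap.le_seminorm ℂ 0 i ψ z.1
  have ak := SchwartzMap.le_seminorm ℂ k i ψ z.1
  have b0 := SchwartzMap.le_seminorm ℂ 0 (n - i) χ z.2
  have bk := SchwartzMap.le_seminorm ℂ k (n - i) χ z.2
  rw [pow_zero, one_mul] at a0 b0
  have a0' := a0.trans (hM 0 i (Nat.zero_le _) hi')
  have ak' := ak.trans (hM k i le_rfl hi')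
  have hM0 : 0 ≤ M := (norm_nonneg _).trans a0'
  have f1 := norm_iteratedFDeriv_comp_fst_le (F := F) ψ i z
  have f2 := norm_iteratedFDeriv_comp_snd_le (E := E) χ (n - i) z
  calc ‖z‖ ^ k * ((n.choose i : ℝ) * ‖iteratedFDeriv ℝ i (fun z : E × F ↦ ψ z.1) z‖ *
        ‖iteratedFDeriv ℝ (n - i) (fun z : E × F ↦ χ z.2) z‖)
      ≤ (‖z.1‖ ^ k + ‖z.2‖ ^ k) * ((n.choose i : ℝ) * ‖iteratedFDeriv ℝ i ψ z.1‖ *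
        ‖iteratedFDeriv ℝ (n - i) χ z.2‖) := by gcongr
    _ = (n.choose i : ℝ) * ((‖z.1‖ ^ k * ‖iteratedFDeriv ℝ i ψ z.1‖) *
          ‖iteratedFDeriv ℝ (n - i) χ z.2‖ + ‖iteratedFDeriv ℝ i ψ z.1‖ *
          (‖z.2‖ ^ k * ‖iteratedFDeriv ℝ (n - i) χ z.2‖)) := by ring
    _ ≤ (n.choose i : ℝ) * (M * SchwartzMap.seminorm ℂ 0 (n - i) χ +
          M * SchwartzMap.seminorm ℂ k (n - i) χ) := by gcongr
    _ = _ := by ring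

/-- The tensor product `ψ ↦ ψ ⊗ χ`, `(ψ ⊗ χ)(x, y) = ψ(x) χ(y)`, on Schwartz functions. -/
def tensorRight (χ : 𝓢(F, ℂ)) : 𝓢(E, ℂ) →L[ℂ] 𝓢(E × F, ℂ) :=
  SchwartzMap.mkCLM (fun ψ z ↦ ψ z.1 * χ z.2)
    (fun _ _ _ ↦ by simp [add_mul]) (fun _ _ _ ↦ by simp [mul_assoc])
    (fun ψ ↦ (contDiff_comp_fst ψ _).mul (contDiff_comp_snd χ _))
    (tensor_bound χ)

lemma tensorRight_apply (χ : 𝓢(F, ℂ)) (ψ : 𝓢(E, ℂ)) (x : E) (y : F) :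
    tensorRight χ ψ (x, y) = ψ x * χ y := rfl

/-- The tensor product `χ ↦ ψ ⊗ χ` as a function of its second factor. -/
def tensorLeft (ψ : 𝓢(E, ℂ)) : 𝓢(F, ℂ) →L[ℂ] 𝓢(E × F, ℂ) :=
  (SchwartzMap.compCLMOfContinuousLinearEquiv ℂ (ContinuousLinearEquiv.prodComm ℝ E F)) ∘L
    tensorRight ψ

lemma tensorLeft_eq (ψ : 𝓢(E, ℂ)) (χ : 𝓢(F, ℂ)) : tensorLeft ψ χ = tensorRight χ ψ :=
  SchwartzMap.ext fun z ↦ mul_comm (χ z.2) (ψ z.1)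

end Tensor

section Weyl

/-- Euclidean space `ℝⁿ`. -/
abbrev X (n : ℕ) : Type := EuclideanSpace ℝ (Fin n)

/-- The linear change of variables `(x, y) ↦ (x + y/2, x - y/2)`. -/
def midpointEquiv (n : ℕ) : (X n × X n) ≃L[ℝ] (X n × X n) where
  toFun p := (p.1 + (1 / 2 : ℝ) • p.2, p.1 - (1 / 2 : ℝ) • p.2)
  invFun p := ((1 / 2 : ℝ) • (p.1 + p.2), p.1 - p.2)
  map_add' p q := by ext <;> simp <;> ring
  map_smul' c p := by ext <;> simp <;> ring
  left_inv p := by ext <;> simp <;> ring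
  right_inv p := by ext <;> simp <;> ring
  continuous_toFun := by fun_prop
  continuous_invFun := by fun_prop

/-- The map `Φ ↦ (2π)⁻ⁿ ∫ e^{-i ξ·y} Φ(x + y/2, x - y/2) dy`. -/
def wignerCLM (n : ℕ) : 𝓢(X n × X n, ℂ) →L[ℂ] 𝓢(X n × X n, ℂ) :=
  ((1 / (2 * Real.pi : ℂ)) ^ n) •
    (partialFourier ∘L SchwartzMap.compCLMOfContinuousLinearEquiv ℂ (midpointEquiv n))

/-- The cross-Wigner transform `W(ψ, φ̄)` of `ψ` and of the complex conjugate of `φ`, see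
`wigner_apply`; it is bilinear in `(ψ, φ)`. -/
def wigner {n : ℕ} (ψ φ : 𝓢(X n, ℂ)) : 𝓢(X n × X n, ℂ) :=
  wignerCLM n (tensorRight φ ψ)

lemma wigner_apply {n : ℕ} (ψ φ : 𝓢(X n, ℂ)) (x ξ : X n) :
    wigner ψ φ (x, ξ) = (1 / (2 * Real.pi : ℂ)) ^ n *
      ∫ y : X n, Complex.exp (-(Complex.I * (inner ℝ ξ y : ℝ))) *
        (ψ (x + (1 / 2 : ℝ) • y) * φ (x - (1 / 2 : ℝ) • y)) := rfl

/-- The Weyl operator `Op^w(a) : 𝓢(ℝⁿ) → 𝓢'(ℝⁿ)` with symbol `a ∈ 𝓢'(ℝ²ⁿ)`: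
`⟨Op^w(a) ψ, φ⟩ = ⟨a, W(ψ, φ̄)⟩`. -/
def weylOp {n : ℕ} (a : 𝓢'(X n × X n, ℂ)) : 𝓢(X n, ℂ) →L[ℂ] 𝓢'(X n, ℂ) where
  toFun ψ := PointwiseConvergenceCLM.precomp ℂ (wignerCLM n ∘L tensorLeft ψ) a
  map_add' ψ ψ' := by
    ext φ
    change a (wignerCLM n (tensorLeft (ψ + ψ') φ)) =
      a (wignerCLM n (tensorLeft ψ φ)) + a (wignerCLM n (tensorLeft ψ' φ))
    simp only [tensorLeft_eq, map_add]
  map_smul' c ψ := by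
    ext φ
    change a (wignerCLM n (tensorLeft (c • ψ) φ)) = c • a (wignerCLM n (tensorLeft ψ φ))
    simp only [tensorLeft_eq, map_smul]
  cont := PointwiseConvergenceCLM.continuous_of_continuous_eval fun φ ↦ by
    change Continuous fun ψ ↦ a (wignerCLM n (tensorLeft ψ φ))
    simp only [tensorLeft_eq]
    exact a.continuous.comp ((wignerCLM n).continuous.comp (tensorRight φ).continuous)

lemma weylOp_apply {n : ℕ} (a : 𝓢'(X n × X n, ℂ)) (ψ φ : 𝓢(X n, ℂ)) :
    weylOp a ψ φ = a (wigner ψ φ) := by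
  change a (wignerCLM n (tensorLeft ψ φ)) = _
  rw [tensorLeft_eq, wigner]

end Weyl

section Symplectic

/-- The standard symplectic form `σ((x, ξ), (x', ξ')) = ξ·x' - ξ'·x` on `ℝ²ᴺ = ℝᴺ × ℝᴺ`. -/
def symplecticForm {N : ℕ} (z z' : X N × X N) : ℝ :=
  inner ℝ z.2 z'.1 - inner ℝ z'.2 z.1

/-- The symplectic group `Sp(2N, ℝ)`. -/
def Sp (N : ℕ) : Subgroup ((X N × X N) ≃L[ℝ] (X N × X N)) where
  carrier := {s | ∀ z z', symplecticForm (s z) (s z') = symplecticForm z z'}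
  mul_mem' {s t} hs ht z z' := (hs (t z) (t z')).trans (ht z z')
  one_mem' _ _ := rfl
  inv_mem' {s} hs z z' := by
    have h := hs (s.symm z) (s.symm z')
    rw [s.apply_symm_apply, s.apply_symm_apply] at h
    exact h.symm

/-- The identification `ℝⁿ × ℝᵏ = ℝⁿ⁺ᵏ`, `(x, y) ↦ (x₁, …, xₙ, y₁, …, yₖ)`. -/
def join (n k : ℕ) : (X n × X k) ≃L[ℝ] X (n + k) := EuclideanSpace.finAddEquivProd.symm

/-- The identification of `((x, ξ), y), η)` with the phase space point `(x, y; ξ, η)`. -/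
def phaseJoin (n k : ℕ) : (((X n × X n) × X k) × X k) ≃L[ℝ] (X (n + k) × X (n + k)) where
  toFun w := (join n k (w.1.1.1, w.1.2), join n k (w.1.1.2, w.2))
  invFun z := (((((join n k).symm z.1).1, ((join n k).symm z.2).1), ((join n k).symm z.1).2),
    ((join n k).symm z.2).2)
  map_add' w w' := by simp only [← map_add, Prod.fst_add, Prod.snd_add, Prod.mk_add_mk]
  map_smul' c w := by
    simp only [← map_smul, Prod.smul_fst, Prod.smul_snd, Prod.smul_mk, RingHom.id_apply]
  left_inv w := by simp
  right_inv z := by simp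
  continuous_toFun := by fun_prop
  continuous_invFun := by fun_prop

/-- The action on test functions that is dual to the extension of symbols:
`Φ ↦ ((x, ξ) ↦ ∫∫ Φ(s⁻¹(x, y; ξ, η)) dy dη)`. -/
def symbolRestriction {n k : ℕ} (s : Sp (n + k)) :
    𝓢(X (n + k) × X (n + k), ℂ) →L[ℂ] 𝓢(X n × X n, ℂ) :=
  partialIntegral ∘L partialIntegral ∘L
    SchwartzMap.compCLMOfContinuousLinearEquiv ℂ ((phaseJoin n k).trans s.1.symm)

lemma symbolRestriction_apply {n k : ℕ} (s : Sp (n + k))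
    (Φ : 𝓢(X (n + k) × X (n + k), ℂ)) (x ξ : X n) :
    symbolRestriction s Φ (x, ξ) =
      ∫ y : X k, ∫ η : X k, Φ (s.1.symm (join n k (x, y), join n k (ξ, η))) := by
  simp only [symbolRestriction, ContinuousLinearMap.comp_apply, partialIntegral_apply]
  rfl

/-- The extension of symbols `E_s[a] = (a ⊗ 1) ∘ s`, a tempered distribution on `ℝ²⁽ⁿ⁺ᵏ⁾`.
Since `|det s| = 1`, this is `⟨E_s[a], Φ⟩ = ⟨a ⊗ 1, Φ ∘ s⁻¹⟩`. -/
def extendSymbol {n k : ℕ} (s : Sp (n + k)) (a : 𝓢'(X n × X n, ℂ)) :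
    𝓢'(X (n + k) × X (n + k), ℂ) :=
  PointwiseConvergenceCLM.precomp ℂ (symbolRestriction s) a

lemma extendSymbol_apply {n k : ℕ} (s : Sp (n + k)) (a : 𝓢'(X n × X n, ℂ))
    (Φ : 𝓢(X (n + k) × X (n + k), ℂ)) :
    extendSymbol s a Φ = a (symbolRestriction s Φ) := rfl

/-- `A' = 𝔼_s[A]`: the operator `A'` is the symplectic dimensional extension of `A`, i.e. `A` has
a Weyl symbol `a`, and `A'` has the Weyl symbol `E_s[a] = (a ⊗ 1) ∘ s`. -/
def IsSymplecticExtension {n k : ℕ} (s : Sp (n + k)) (A : 𝓢(X n, ℂ) →L[ℂ] 𝓢'(X n, ℂ))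
    (A' : 𝓢(X (n + k), ℂ) →L[ℂ] 𝓢'(X (n + k), ℂ)) : Prop :=
  ∃ a : 𝓢'(X n × X n, ℂ), A = weylOp a ∧ A' = weylOp (extendSymbol s a)

end Symplectic

section Metaplectic

/-- A generating function `W(x, x') = ½ Px·x - Lx·x' + ½ Qx'·x'` with `P`, `Q` symmetric and
`det L ≠ 0`, together with a Maslov index `m`, i.e. `m π` is a choice of `arg det L`. -/
structure GeneratingFunction (N : ℕ) where
  P : X N →ₗ[ℝ] X N
  L : X N →ₗ[ℝ] X N
  Q : X N →ₗ[ℝ] X N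
  m : ℤ
  isSymmetric_P : P.IsSymmetric
  isSymmetric_Q : Q.IsSymmetric
  det_ne_zero : LinearMap.det L ≠ 0
  maslov : LinearMap.det L = (-1 : ℝ) ^ m * |LinearMap.det L|

/-- The quadratic form `W(x, x')`. -/
def GeneratingFunction.toFun {N : ℕ} (W : GeneratingFunction N) (x x' : X N) : ℝ :=
  1 / 2 * inner ℝ (W.P x) x - inner ℝ (W.L x) x' + 1 / 2 * inner ℝ (W.Q x') x'

/-- `S` is the quadratic Fourier transform
`S_{W,m} f(x) = (1/(2πi))^{N/2} iᵐ |det L|^{1/2} ∫ e^{i W(x, x')} f(x') dx'`. -/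
def GeneratingFunction.IsQuadraticFourier {N : ℕ} (W : GeneratingFunction N)
    (S : 𝓢(X N, ℂ) ≃L[ℂ] 𝓢(X N, ℂ)) : Prop :=
  ∀ (f : 𝓢(X N, ℂ)) (x : X N),
    S f x = (1 / (2 * Real.pi * Complex.I)) ^ ((N : ℂ) / 2) *
      (Complex.I ^ W.m * (Real.sqrt |LinearMap.det W.L| : ℝ)) *
        ∫ x' : X N, Complex.exp (Complex.I * (W.toFun x x' : ℝ)) * f x'

/-- `s` is the free symplectic map generated by `W`: `(x, ξ) = s(x', ξ')` if and only if
`ξ = ∂ₓW(x, x') = Px - Lᵀx'` and `ξ' = -∂ₓ'W(x, x') = Lx - Qx'`. -/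
def GeneratingFunction.Generates {N : ℕ} (W : GeneratingFunction N) (s : Sp N) : Prop :=
  ∀ x ξ x' ξ' : X N, (x, ξ) = s.1 (x', ξ') ↔
    ξ = W.P x - LinearMap.adjoint W.L x' ∧ ξ' = W.L x - W.Q x'

/-- The metaplectic group `Mp(2N, ℝ)`, presented as the graph of its projection onto
`Sp(2N, ℝ)`: the group of pairs `(S, s)` generated by the pairs `(S_{W,m}, s_W)`.  Metaplectic
operators are determined by their action on `𝓢(ℝᴺ)`, which they map onto itself. -/
def metaplecticGroup (N : ℕ) : Subgroup ((𝓢(X N, ℂ) ≃L[ℂ] 𝓢(X N, ℂ)) × Sp N) :=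
  Subgroup.closure {p | ∃ W : GeneratingFunction N, W.IsQuadraticFourier p.1 ∧ W.Generates p.2}

/-- `S` is one of the metaplectic operators that project onto `s`. -/
def IsMetaplectic {N : ℕ} (S : 𝓢(X N, ℂ) ≃L[ℂ] 𝓢(X N, ℂ)) (s : Sp N) : Prop :=
  (S, s) ∈ metaplecticGroup N

end Metaplectic

section Intertwiners

variable {n k : ℕ}

/-- The intertwiner `T_{S,χ} ψ = S⁻¹(ψ ⊗ χ)`. -/
def intertwiner (S : 𝓢(X (n + k), ℂ) ≃L[ℂ] 𝓢(X (n + k), ℂ)) (χ : 𝓢(X k, ℂ))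
    (ψ : 𝓢(X n, ℂ)) : 𝓢(X (n + k), ℂ) :=
  S.symm (SchwartzMap.compCLMOfContinuousLinearEquiv ℂ (join n k).symm (tensorRight χ ψ))

lemma hasTemperateGrowth_conj_snd (χ : 𝓢(X k, ℂ)) :
    Function.HasTemperateGrowth fun z : X n × X k ↦ starRingEnd ℂ (χ z.2) :=
  ((Complex.conjCLE : ℂ →L[ℝ] ℂ).hasTemperateGrowth).comp
    (χ.hasTemperateGrowth.comp (ContinuousLinearMap.snd ℝ (X n) (X k)).hasTemperateGrowth)

/-- The adjoint `T*_{S,χ} Ψ(x) = ∫ conj (χ(y)) (SΨ)(x, y) dy`, see `intertwinerAdjoint_apply`. -/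
def intertwinerAdjoint (S : 𝓢(X (n + k), ℂ) ≃L[ℂ] 𝓢(X (n + k), ℂ)) (χ : 𝓢(X k, ℂ))
    (Ψ : 𝓢(X (n + k), ℂ)) : 𝓢(X n, ℂ) :=
  partialIntegral (SchwartzMap.smulLeftCLM ℂ (fun z : X n × X k ↦ starRingEnd ℂ (χ z.2))
    (SchwartzMap.compCLMOfContinuousLinearEquiv ℂ (join n k) (S Ψ)))

lemma intertwinerAdjoint_apply (S : 𝓢(X (n + k), ℂ) ≃L[ℂ] 𝓢(X (n + k), ℂ)) (χ : 𝓢(X k, ℂ))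
    (Ψ : 𝓢(X (n + k), ℂ)) (x : X n) :
    intertwinerAdjoint S χ Ψ x =
      ∫ y : X k, starRingEnd ℂ (χ y) * S Ψ (join n k (x, y)) := by
  rw [intertwinerAdjoint, partialIntegral_apply]
  simp only [SchwartzMap.smulLeftCLM_apply_apply (hasTemperateGrowth_conj_snd χ)]
  rfl

end Intertwiners

section Spectral

/-- `ψ ∈ 𝓢(ℝᴺ)` is an eigenfunction of `A : 𝓢(ℝᴺ) → 𝓢'(ℝᴺ)` for the eigenvalue `μ`: it is
nonzero, and `Aψ = μψ` as tempered distributions. -/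
def IsEigenfunction {N : ℕ} (A : 𝓢(X N, ℂ) →L[ℂ] 𝓢'(X N, ℂ)) (μ : ℂ) (ψ : 𝓢(X N, ℂ)) : Prop :=
  ψ ≠ 0 ∧ A ψ = μ • SchwartzMap.toTemperedDistributionCLM (X N) ℂ volume ψ

/-- `μ` is an eigenvalue of `A`. -/
def IsEigenvalue {N : ℕ} (A : 𝓢(X N, ℂ) →L[ℂ] 𝓢'(X N, ℂ)) (μ : ℂ) : Prop :=
  ∃ ψ : 𝓢(X N, ℂ), IsEigenfunction A μ ψ

/-- The family `v` of Schwartz functions is an orthonormal (Hilbert) basis of `L²(ℝᴺ)`. -/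
def IsOrthonormalBasis {N : ℕ} {ι : Type*} (v : ι → 𝓢(X N, ℂ)) : Prop :=
  ∃ b : HilbertBasis ι ℂ (Lp ℂ 2 (volume : Measure (X N))), ∀ i, b i = (v i).toLp 2 volume

end Spectral

end

end SymplecticExtension

open SymplecticExtension

/-!
All assertions follow from two properties of a metaplectic operator `S` with projection `s`: it is
`L²`-unitary, and the sesquilinear cross-Wigner transform satisfies `W(Sψ, Sφ) ∘ s = W(ψ, φ)`
(`IsWignerCovariant`). Pairs `(S, s)` with these properties form a group. It contains the chirps
with the vertical shears, the dilations, and the Fourier transform; for the latter,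
`W(ψ, φ)(x, ξ)` is written as the pairing of `ψ` with the reflection of `φ` in the point `(x, ξ)`,
and the Fourier transform maps such reflections to each other. A quadratic Fourier transform
`S_{W,m}` is a phase times a product of these operators, so every metaplectic operator is covariant
(`IsMetaplectic.isWignerCovariant`).

That `A` and its extension have the same eigenvalues is a statement about every `s`, so a covariant
operator over every symplectic map is needed (`exists_isWignerCovariant`). If `s(0, p) = (Bp, Dp)`,
then `B + tD` is injective for some real `t`, because vectors `p_t` in the kernels for different `t`
have mutually orthogonal nonzero images `Dp_t`. A horizontal shear thus makes `s` free, and a free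
map is reduced to a vertical shear by a vertical shear, the Fourier transform and a dilation.

By covariance and Fourier inversion in the variables `(y, η)`, the map dual to the extension of
symbols sends `W(T_{S,χ}ψ, Φ)` to `W(ψ, T*_{S,χ}Φ)` and `W(Ψ, T_{S,χ}φ)` to `W(T*_{S,χ}Ψ, φ)`
(`symbolRestriction_wigner_intertwiner`, `symbolRestriction_wigner_conjS_intertwiner`). Since
`T*_{S,χ}` is the adjoint of `T_{S,χ}`, both intertwiners carry the weak eigenvalue equation over
from one operator to the other. An intertwiner `T_{S,χ}` with `χ ≠ 0` is injective, and for
`Ψ ≠ 0` some `T*_{S,χ}Ψ` is nonzero.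

For orthonormal bases `ψ_j` and `χ_l`, orthonormality of `T_{S,χ_l}ψ_j` is the product formula for
the inner product. For completeness, Parseval's identity is verified on Schwartz functions `Φ`: the
sum over `j` gives `‖T*_{S,χ_l}Φ‖²`, and the sum over `l` is Parseval's identity for the slices of
`SΦ`, integrated over `x` (`IsWignerCovariant.tsum_enorm_intertwinerAdjoint`).
-/

namespace SymplecticExtension

noncomputable section

/-! ### Unitary operators that are covariant for the Wigner transform -/

/-- Complex conjugation of Schwartz functions. -/
def conjS {N : ℕ} : 𝓢(X N, ℂ) →L[ℝ] 𝓢(X N, ℂ) :=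
  SchwartzMap.postcompCLM (Complex.conjCLE : ℂ →L[ℝ] ℂ)

@[simp] lemma conjS_apply {N : ℕ} (φ : 𝓢(X N, ℂ)) (x : X N) :
    conjS φ x = starRingEnd ℂ (φ x) := rfl

@[simp] lemma conjS_conjS {N : ℕ} (φ : 𝓢(X N, ℂ)) : conjS (conjS φ) = φ := by
  ext x; simp

/-- The operator `S` is `L²`-unitary, and conjugation by `S` acts on phase space as the symplectic
map `s`: `W(Sψ, Sφ) ∘ s = W(ψ, φ)` for the sesquilinear cross-Wigner transform. These are the only
properties of metaplectic operators that the spectral statements use. -/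
structure IsWignerCovariant {N : ℕ} (S : 𝓢(X N, ℂ) ≃L[ℂ] 𝓢(X N, ℂ)) (s : Sp N) : Prop where
  integral_mul_conj : ∀ ψ φ : 𝓢(X N, ℂ),
    ∫ x, S ψ x * starRingEnd ℂ (S φ x) = ∫ x, ψ x * starRingEnd ℂ (φ x)
  wigner_map : ∀ (ψ φ : 𝓢(X N, ℂ)) (z : X N × X N),
    wigner (S ψ) (conjS (S φ)) (s.1 z) = wigner ψ (conjS φ) z

namespace IsWignerCovariant

variable {N : ℕ} {S T : 𝓢(X N, ℂ) ≃L[ℂ] 𝓢(X N, ℂ)} {s t : Sp N}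

lemma one : IsWignerCovariant (1 : 𝓢(X N, ℂ) ≃L[ℂ] 𝓢(X N, ℂ)) (1 : Sp N) :=
  ⟨fun _ _ ↦ rfl, fun _ _ _ ↦ rfl⟩

lemma mul (hS : IsWignerCovariant S s) (hT : IsWignerCovariant T t) :
    IsWignerCovariant (S * T) (s * t) :=
  ⟨fun ψ φ ↦ (hS.1 (T ψ) (T φ)).trans (hT.1 ψ φ),
    fun ψ φ z ↦ (hS.2 (T ψ) (T φ) (t.1 z)).trans (hT.2 ψ φ z)⟩

lemma inv (hS : IsWignerCovariant S s) : IsWignerCovariant S⁻¹ s⁻¹ := by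
  refine ⟨fun ψ φ ↦ ?_, fun ψ φ z ↦ ?_⟩
  · have h := hS.1 (S.symm ψ) (S.symm φ)
    rw [S.apply_symm_apply, S.apply_symm_apply] at h
    exact h.symm
  · have h := hS.2 (S.symm ψ) (S.symm φ) (s.1.symm z)
    rw [S.apply_symm_apply, S.apply_symm_apply, s.1.apply_symm_apply] at h
    exact h.symm

/-- Covariance is insensitive to a phase factor. -/
lemma of_phase {c : ℂ} (hc : ‖c‖ = 1) (hT : IsWignerCovariant T s)
    (h : ∀ (f : 𝓢(X N, ℂ)) (x : X N), S f x = c * T f x) : IsWignerCovariant S s := by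
  have hcc : c * starRingEnd ℂ c = 1 := by
    rw [Complex.mul_conj, Complex.normSq_eq_norm_sq, hc]; simp
  have key : ∀ a b : ℂ, (c * a) * starRingEnd ℂ (c * b) = a * starRingEnd ℂ b := fun a b ↦ by
    rw [map_mul]; linear_combination (a * starRingEnd ℂ b) * hcc
  refine ⟨fun ψ φ ↦ ?_, fun ψ φ z ↦ ?_⟩
  · rw [← hT.1 ψ φ]
    simp only [h, key]
  · rw [← hT.2 ψ φ z, ← Prod.mk.eta (p := s.1 z), wigner_apply, wigner_apply]
    simp only [conjS_apply, h, key]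

end IsWignerCovariant

/-! ### Chirps -/

/-- The symplectic shear `(x, ξ) ↦ (x, ξ + Px)`. -/
def chirpSp {N : ℕ} (P : X N →ₗ[ℝ] X N) (hP : P.IsSymmetric) : Sp N :=
  ⟨{ toFun := fun z ↦ (z.1, z.2 + P z.1)
     invFun := fun z ↦ (z.1, z.2 - P z.1)
     map_add' := fun z w ↦ by
       simp only [Prod.fst_add, Prod.snd_add, map_add, Prod.mk_add_mk]
       rw [add_add_add_comm]
     map_smul' := fun c z ↦ by simp
     left_inv := fun z ↦ by simp
     right_inv := fun z ↦ by simp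
     continuous_toFun := by
       have := P.continuous_of_finiteDimensional
       change Continuous fun z : X N × X N ↦ (z.1, z.2 + P z.1)
       fun_prop
     continuous_invFun := by
       have := P.continuous_of_finiteDimensional
       change Continuous fun z : X N × X N ↦ (z.1, z.2 - P z.1)
       fun_prop }, fun z w ↦ by
    change inner ℝ (z.2 + P z.1) w.1 - inner ℝ (w.2 + P w.1) z.1 =
      inner ℝ z.2 w.1 - inner ℝ w.2 z.1
    rw [inner_add_left, inner_add_left, hP z.1 w.1, real_inner_comm z.1 (P w.1)]
    ring⟩

lemma chirpSp_apply {N : ℕ} (P : X N →ₗ[ℝ] X N) (hP : P.IsSymmetric) (z : X N × X N) :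
    (chirpSp P hP).1 z = (z.1, z.2 + P z.1) := rfl

/-- All derivatives of `t ↦ e^{it}` are bounded by `1`. -/
lemma hasTemperateGrowth_cexp_mul_I :
    Function.HasTemperateGrowth fun t : ℝ ↦ Complex.exp (Complex.I * t) := by
  have hd : ∀ n : ℕ, iteratedDeriv n (fun t : ℝ ↦ Complex.exp (Complex.I * t)) =
      fun t : ℝ ↦ Complex.I ^ n * Complex.exp (Complex.I * t) := by
    intro n
    induction n with
    | zero => ext t; simp
    | succ n ih =>
      rw [iteratedDeriv_succ, ih]
      ext t
      have h : HasDerivAt (fun t : ℝ ↦ Complex.I * (t : ℂ)) (Complex.I * 1) t :=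
        (Complex.ofRealCLM.hasDerivAt (x := t)).const_mul Complex.I
      rw [(h.cexp.const_mul (Complex.I ^ n)).deriv]
      ring
  refine ⟨?_, fun n ↦ ⟨0, 1, fun t ↦ ?_⟩⟩
  · exact (Complex.contDiff_exp.of_le le_top).comp
      (contDiff_const.mul Complex.ofRealCLM.contDiff)
  · rw [norm_iteratedFDeriv_eq_norm_iteratedDeriv, hd]
    simp [Complex.norm_exp]

/-- The chirp `x ↦ e^{i Px·x/2}`. -/
def chirpFun {N : ℕ} (P : X N →ₗ[ℝ] X N) (x : X N) : ℂ :=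
  Complex.exp (Complex.I * (1 / 2 * inner ℝ (P x) x : ℝ))

lemma hasTemperateGrowth_chirpFun {N : ℕ} (P : X N →ₗ[ℝ] X N) :
    Function.HasTemperateGrowth (chirpFun P) := by
  refine hasTemperateGrowth_cexp_mul_I.comp
    ((Function.HasTemperateGrowth.const (1 / 2 : ℝ)).mul ?_)
  exact (innerSL ℝ).bilinear_hasTemperateGrowth
    (LinearMap.toContinuousLinearMap P).hasTemperateGrowth Function.HasTemperateGrowth.id'

lemma chirpFun_mul_chirpFun_neg {N : ℕ} (P : X N →ₗ[ℝ] X N) (x : X N) :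
    chirpFun P x * chirpFun (-P) x = 1 := by
  simp [chirpFun, ← Complex.exp_add]

lemma chirpFun_neg_mul_chirpFun {N : ℕ} (P : X N →ₗ[ℝ] X N) (x : X N) :
    chirpFun (-P) x * chirpFun P x = 1 := by
  rw [mul_comm, chirpFun_mul_chirpFun_neg]

lemma conj_chirpFun {N : ℕ} (P : X N →ₗ[ℝ] X N) (x : X N) :
    starRingEnd ℂ (chirpFun P x) = chirpFun (-P) x := by
  simp only [chirpFun, ← Complex.exp_conj, map_mul, Complex.conj_I, Complex.conj_ofReal,
    LinearMap.neg_apply, inner_neg_left]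
  push_cast
  ring_nf

/-- The unitary operator of multiplication by the chirp `x ↦ e^{i Px·x/2}`. -/
def chirp {N : ℕ} (P : X N →ₗ[ℝ] X N) : 𝓢(X N, ℂ) ≃L[ℂ] 𝓢(X N, ℂ) :=
  ContinuousLinearEquiv.equivOfInverse
    (SchwartzMap.smulLeftCLM ℂ (chirpFun P)) (SchwartzMap.smulLeftCLM ℂ (chirpFun (-P)))
    (fun f ↦ by
      ext x
      simp only [SchwartzMap.smulLeftCLM_apply_apply (hasTemperateGrowth_chirpFun _), smul_eq_mul]
      rw [← mul_assoc, chirpFun_neg_mul_chirpFun, one_mul])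
    (fun f ↦ by
      ext x
      simp only [SchwartzMap.smulLeftCLM_apply_apply (hasTemperateGrowth_chirpFun _), smul_eq_mul]
      rw [← mul_assoc, chirpFun_mul_chirpFun_neg, one_mul])

lemma chirp_apply {N : ℕ} (P : X N →ₗ[ℝ] X N) (f : 𝓢(X N, ℂ)) (x : X N) :
    chirp P f x = chirpFun P x * f x :=
  SchwartzMap.smulLeftCLM_apply_apply (hasTemperateGrowth_chirpFun _) f x

lemma isWignerCovariant_chirp {N : ℕ} (P : X N →ₗ[ℝ] X N) (hP : P.IsSymmetric) :
    IsWignerCovariant (chirp P) (chirpSp P hP) := by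
  refine ⟨fun ψ φ ↦ ?_, fun ψ φ z ↦ ?_⟩
  · congr 1
    ext x
    rw [chirp_apply, chirp_apply, map_mul, conj_chirpFun]
    linear_combination (ψ x * starRingEnd ℂ (φ x)) * chirpFun_mul_chirpFun_neg P x
  · obtain ⟨x, ξ⟩ := z
    rw [chirpSp_apply, wigner_apply, wigner_apply]
    congr 2
    ext y
    have key : Complex.exp (-(Complex.I * (inner ℝ (ξ + P x) y : ℝ))) *
        (chirpFun P (x + (1 / 2 : ℝ) • y) * chirpFun (-P) (x - (1 / 2 : ℝ) • y)) =
        Complex.exp (-(Complex.I * (inner ℝ ξ y : ℝ))) := by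
      rw [chirpFun, chirpFun, ← Complex.exp_add, ← Complex.exp_add]
      congr 1
      have h1 : inner ℝ (P y) x = inner ℝ (P x) y := by rw [hP y x, real_inner_comm]
      simp only [map_add, map_sub, map_smul, inner_add_left, inner_add_right, inner_sub_left,
        inner_sub_right, real_inner_smul_left, real_inner_smul_right, LinearMap.neg_apply,
        inner_neg_left, h1]
      push_cast
      ring
    simp only [conjS_apply, chirp_apply, map_mul, conj_chirpFun]
    rw [← key]
    ring

/-! ### Dilations -/

/-- The transpose of an invertible linear map, as an invertible linear map. -/
def adjointEquiv {N : ℕ} (L : X N ≃L[ℝ] X N) : X N ≃L[ℝ] X N :=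
  ContinuousLinearEquiv.equivOfInverse (ContinuousLinearMap.adjoint (L : X N →L[ℝ] X N))
    (ContinuousLinearMap.adjoint (L.symm : X N →L[ℝ] X N))
    (fun ξ ↦ ext_inner_right ℝ fun v ↦ by simp [ContinuousLinearMap.adjoint_inner_left])
    (fun ξ ↦ ext_inner_right ℝ fun v ↦ by simp [ContinuousLinearMap.adjoint_inner_left])

/-- The symplectic map `(x, ξ) ↦ (L⁻¹x, Lᵀξ)`. -/
def dilationSp {N : ℕ} (L : X N ≃L[ℝ] X N) : Sp N :=
  ⟨L.symm.prodCongr (adjointEquiv L),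
    fun z w ↦ by
      change inner ℝ (ContinuousLinearMap.adjoint (L : X N →L[ℝ] X N) z.2) (L.symm w.1) -
        inner ℝ (ContinuousLinearMap.adjoint (L : X N →L[ℝ] X N) w.2) (L.symm z.1) = _
      simp [ContinuousLinearMap.adjoint_inner_left, symplecticForm]⟩

lemma dilationSp_apply {N : ℕ} (L : X N ≃L[ℝ] X N) (z : X N × X N) :
    (dilationSp L).1 z =
      (L.symm z.1, ContinuousLinearMap.adjoint (L : X N →L[ℝ] X N) z.2) := rfl

lemma integral_comp_continuousLinearEquiv {N : ℕ} (L : X N ≃L[ℝ] X N) (f : X N → ℂ) :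
    |LinearMap.det (L : X N →ₗ[ℝ] X N)| * ∫ x, f (L x) = ∫ x, f x := by
  have h := integral_image_eq_integral_abs_det_fderiv_smul (volume : Measure (X N))
    (s := Set.univ) (f := L) (f' := fun _ ↦ (L : X N →L[ℝ] X N)) MeasurableSet.univ
    (fun x _ ↦ L.hasFDerivAt.hasFDerivWithinAt) L.injective.injOn f
  rw [Set.image_univ, L.surjective.range_eq, setIntegral_univ, setIntegral_univ,
    integral_smul] at h
  rw [h, Complex.real_smul]
  rfl

lemma abs_det_ne_zero {N : ℕ} (L : X N ≃L[ℝ] X N) :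
    |LinearMap.det (L : X N →ₗ[ℝ] X N)| ≠ 0 :=
  abs_ne_zero.2 L.toLinearEquiv.isUnit_det'.ne_zero

/-- The unitary dilation `f ↦ |det L|^{1/2} f ∘ L`. -/
def dilation {N : ℕ} (L : X N ≃L[ℝ] X N) : 𝓢(X N, ℂ) ≃L[ℂ] 𝓢(X N, ℂ) :=
  ContinuousLinearEquiv.equivOfInverse
    ((Real.sqrt |LinearMap.det (L : X N →ₗ[ℝ] X N)| : ℂ) •
      SchwartzMap.compCLMOfContinuousLinearEquiv ℂ L)
    ((Real.sqrt |LinearMap.det (L : X N →ₗ[ℝ] X N)| : ℂ)⁻¹ •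
      SchwartzMap.compCLMOfContinuousLinearEquiv ℂ L.symm)
    (fun f ↦ by
      have h : (Real.sqrt |LinearMap.det (L : X N →ₗ[ℝ] X N)| : ℂ) ≠ 0 :=
        Complex.ofReal_ne_zero.2 (Real.sqrt_ne_zero'.2 ((abs_nonneg _).lt_of_ne'
          (abs_det_ne_zero L)))
      ext x
      simp [h])
    (fun f ↦ by
      have h : (Real.sqrt |LinearMap.det (L : X N →ₗ[ℝ] X N)| : ℂ) ≠ 0 :=
        Complex.ofReal_ne_zero.2 (Real.sqrt_ne_zero'.2 ((abs_nonneg _).lt_of_ne'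
          (abs_det_ne_zero L)))
      ext x
      simp [h])

lemma dilation_apply {N : ℕ} (L : X N ≃L[ℝ] X N) (f : 𝓢(X N, ℂ)) (x : X N) :
    dilation L f x = (Real.sqrt |LinearMap.det (L : X N →ₗ[ℝ] X N)| : ℂ) * f (L x) := rfl

lemma dilation_mul_conj {N : ℕ} (L : X N ≃L[ℝ] X N) (f g : 𝓢(X N, ℂ)) (x y : X N) :
    dilation L f x * starRingEnd ℂ (dilation L g y) =
      |LinearMap.det (L : X N →ₗ[ℝ] X N)| * (f (L x) * starRingEnd ℂ (g (L y))) := by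
  have h : (Real.sqrt |LinearMap.det (L : X N →ₗ[ℝ] X N)| : ℂ) *
      (Real.sqrt |LinearMap.det (L : X N →ₗ[ℝ] X N)| : ℂ) =
      (|LinearMap.det (L : X N →ₗ[ℝ] X N)| : ℝ) := by
    rw [← Complex.ofReal_mul, Real.mul_self_sqrt (abs_nonneg _)]
  rw [dilation_apply, dilation_apply, map_mul, Complex.conj_ofReal, ← h]
  ring

lemma isWignerCovariant_dilation {N : ℕ} (L : X N ≃L[ℝ] X N) :
    IsWignerCovariant (dilation L) (dilationSp L) := by
  refine ⟨fun ψ φ ↦ ?_, fun ψ φ z ↦ ?_⟩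
  · simp only [dilation_mul_conj]
    rw [integral_const_mul]
    exact integral_comp_continuousLinearEquiv L fun x ↦ ψ x * starRingEnd ℂ (φ x)
  · obtain ⟨x, ξ⟩ := z
    rw [dilationSp_apply, wigner_apply, wigner_apply]
    conv_rhs => rw [← integral_comp_continuousLinearEquiv L, ← integral_const_mul]
    congr 2
    ext y
    simp only [conjS_apply, dilation_mul_conj, map_add, map_sub, map_smul,
      ContinuousLinearMap.adjoint_inner_left]
    simp
    ring

/-! ### The Fourier transform -/

/-- The symplectic map `(x, ξ) ↦ (ξ/2π, -2πx)` that belongs to the Fourier transform with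
kernel `e^{-2πi x·x'}`. -/
def fourierSp (N : ℕ) : Sp N :=
  ⟨{ toFun := fun z ↦ ((2 * Real.pi)⁻¹ • z.2, -((2 * Real.pi) • z.1))
     invFun := fun z ↦ (-((2 * Real.pi)⁻¹ • z.2), (2 * Real.pi) • z.1)
     map_add' := fun z w ↦ by simp [add_comm]
     map_smul' := fun c z ↦ by simp [smul_comm c]
     left_inv := fun z ↦ by
       have h : (2 * Real.pi) * (2 * Real.pi)⁻¹ = 1 := mul_inv_cancel₀ (by positivity)
       simp only [smul_neg, neg_neg, smul_smul, h, mul_comm _ (2 * Real.pi), one_smul]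
     right_inv := fun z ↦ by
       have h : (2 * Real.pi) * (2 * Real.pi)⁻¹ = 1 := mul_inv_cancel₀ (by positivity)
       simp only [smul_neg, neg_neg, smul_smul, h, mul_comm _ (2 * Real.pi), one_smul]
     continuous_toFun := by fun_prop
     continuous_invFun := by fun_prop }, fun z w ↦ by
    change inner ℝ (-((2 * Real.pi) • z.1)) ((2 * Real.pi)⁻¹ • w.2) -
      inner ℝ (-((2 * Real.pi) • w.1)) ((2 * Real.pi)⁻¹ • z.2) =
      inner ℝ z.2 w.1 - inner ℝ w.2 z.1
    have h : (2 * Real.pi) * (2 * Real.pi)⁻¹ = 1 := mul_inv_cancel₀ (by positivity)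
    simp only [inner_neg_left, real_inner_smul_left, real_inner_smul_right]
    rw [real_inner_comm w.2 z.1, real_inner_comm z.2 w.1]
    linear_combination (inner ℝ z.2 w.1 - inner ℝ w.2 z.1) * h⟩

lemma fourierSp_apply {N : ℕ} (z : X N × X N) :
    (fourierSp N).1 z = ((2 * Real.pi)⁻¹ • z.2, -((2 * Real.pi) • z.1)) := rfl

/-- The Wigner transform as the pairing of `ψ` with the reflection of `φ` in the phase space point
`(x, ξ)`. -/
lemma wigner_eq_integral_reflection {N : ℕ} (ψ φ : 𝓢(X N, ℂ)) (x ξ : X N) :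
    wigner ψ φ (x, ξ) = (1 / (2 * Real.pi : ℂ)) ^ N * (2 ^ N *
      ∫ u : X N, ψ u * (Complex.exp (-(Complex.I * (2 * inner ℝ ξ (u - x) : ℝ))) *
        φ ((2 : ℝ) • x - u))) := by
  rw [wigner_apply]
  congr 1
  -- Substitute `w = y/2`, which accounts for the factor `2ᴺ`, and then `u = x + w`.
  have h := Measure.integral_comp_smul (volume : Measure (X N)) (fun w : X N ↦
    ψ (x + w) * (Complex.exp (-(Complex.I * (2 * inner ℝ ξ w : ℝ))) * φ (x - w))) (1 / 2 : ℝ)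
  have h2 := integral_add_left_eq_self (μ := (volume : Measure (X N))) (fun u : X N ↦
    ψ u * (Complex.exp (-(Complex.I * (2 * inner ℝ ξ (u - x) : ℝ))) *
        φ ((2 : ℝ) • x - u))) x
  rw [← h2]
  have e : ∀ w : X N, (2 : ℝ) • x - (x + w) = x - w := fun w ↦ by rw [two_smul]; abel
  simp only [e, add_sub_cancel_left]
  have e2 : |((1 / 2 : ℝ) ^ Module.finrank ℝ (X N))⁻¹| = 2 ^ N := by simp
  rw [e2, Complex.real_smul] at h
  push_cast at h ⊢
  rw [← h]
  congr 1
  ext y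
  rw [real_inner_smul_right]
  push_cast
  ring_nf

lemma conjS_fourier {N : ℕ} (φ : 𝓢(X N, ℂ)) : conjS (𝓕 φ) = 𝓕⁻ (conjS φ) := by
  ext x
  rw [conjS_apply, SchwartzMap.fourier_coe, SchwartzMap.fourierInv_coe, Real.fourier_eq',
    Real.fourierInv_eq', ← integral_conj]
  congr 1
  ext v
  simp only [smul_eq_mul, map_mul, ← Complex.exp_conj, Complex.conj_ofReal, Complex.conj_I,
    conjS_apply]
  push_cast
  ring_nf

lemma fourierInv_fourierInv {N : ℕ} (φ : 𝓢(X N, ℂ)) (x : X N) : 𝓕⁻ (𝓕⁻ φ) x = φ (-x) := by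
  rw [SchwartzMap.fourierInv_apply_eq]
  simp

lemma integrable_reflection {N : ℕ} (φ : 𝓢(X N, ℂ)) (x ξ : X N) :
    Integrable fun u : X N ↦ Complex.exp (-(Complex.I * (2 * inner ℝ ξ (u - x) : ℝ))) *
        φ ((2 : ℝ) • x - u) := by
  have h := (φ.integrable (μ := volume)).comp_sub_left ((2 : ℝ) • x)
  refine h.norm.mono' (Continuous.aestronglyMeasurable ?_) (Filter.Eventually.of_forall fun u ↦ ?_)
  · have := φ.continuous
    fun_prop
  · rw [norm_mul, Complex.norm_exp]
    simp

/-- The Fourier transform exchanges reflections in phase space points. -/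
lemma fourier_reflection {N : ℕ} (φ : 𝓢(X N, ℂ)) (x ξ v : X N) :
    𝓕 (fun u : X N ↦ Complex.exp (-(Complex.I *
        (2 * inner ℝ (-((2 * Real.pi) • x)) (u - (2 * Real.pi)⁻¹ • ξ) : ℝ))) *
        (𝓕⁻ φ) ((2 : ℝ) • ((2 * Real.pi)⁻¹ • ξ) - u)) v =
      Complex.exp (-(Complex.I * (2 * inner ℝ ξ (v - x) : ℝ))) * φ ((2 : ℝ) • x - v) := by
  -- The substitution `w = ξ/π - u` turns the left-hand side into `𝓕⁻ (𝓕⁻ φ)` at `v - 2x`, times an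
  -- exponential factor.
  have h0 := fourierInv_fourierInv φ (v - (2 : ℝ) • x)
  rw [neg_sub] at h0
  rw [← h0, SchwartzMap.fourierInv_coe (𝓕⁻ φ), Real.fourierInv_eq', Real.fourier_eq',
    ← integral_const_mul,
    ← integral_sub_left_eq_self (μ := (volume : Measure (X N))) _
      ((2 : ℝ) • ((2 * Real.pi)⁻¹ • ξ))]
  congr 1
  ext w
  rw [sub_sub_cancel, smul_eq_mul, smul_eq_mul, ← mul_assoc, ← mul_assoc, ← Complex.exp_add,
    ← Complex.exp_add]
  congr 2
  have hpi : (Real.pi : ℂ) ≠ 0 := by exact_mod_cast Real.pi_ne_zero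
  simp only [inner_sub_left, inner_sub_right, real_inner_smul_left, real_inner_smul_right,
    inner_neg_left]
  rw [real_inner_comm ξ x, real_inner_comm w x]
  push_cast
  field_simp
  ring

lemma isWignerCovariant_fourier (N : ℕ) :
    IsWignerCovariant (FourierTransform.fourierCLE ℂ 𝓢(X N, ℂ)) (fourierSp N) := by
  refine ⟨fun ψ φ ↦ ?_, fun ψ φ z ↦ ?_⟩
  · have h := SchwartzMap.integral_inner_fourier_fourier φ ψ
    simp only [FourierTransform.fourierCLE_apply]
    simpa only [RCLike.inner_apply] using h
  · obtain ⟨x, ξ⟩ := z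
    simp only [FourierTransform.fourierCLE_apply, conjS_fourier, fourierSp_apply]
    rw [wigner_eq_integral_reflection, wigner_eq_integral_reflection]
    congr 2
    have h := VectorFourier.integral_fourierIntegral_smul_eq_flip (L := innerₗ (X N))
      (μ := volume) (ν := volume)
      Real.continuous_fourierChar continuous_inner (ψ.integrable (μ := volume))
      (integrable_reflection (𝓕⁻ (conjS φ)) ((2 * Real.pi)⁻¹ • ξ) (-((2 * Real.pi) • x)))
    rw [flip_innerₗ] at h
    refine h.trans ?_
    congr 1
    ext v
    exact congrArg (ψ v * ·) (fourier_reflection (conjS φ) x ξ v)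

/-! ### Metaplectic operators are covariant -/

namespace GeneratingFunction

variable {N : ℕ} (W : GeneratingFunction N)

/-- The matrix `L/2π` of a generating function, which adapts `e^{-i Lx·x'}` to the kernel
`e^{-2πi x·x'}` of the Fourier transform. -/
def scaledL : X N ≃L[ℝ] X N :=
  (LinearEquiv.ofIsUnitDet (f := (2 * Real.pi)⁻¹ • W.L)
    (v := (EuclideanSpace.basisFun (Fin N) ℝ).toBasis)
    (v' := (EuclideanSpace.basisFun (Fin N) ℝ).toBasis) (by
      rw [LinearMap.det_toMatrix, LinearMap.det_smul]
      exact (mul_ne_zero (pow_ne_zero _ (inv_ne_zero (by positivity))) W.det_ne_zero).isUnit)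
    ).toContinuousLinearEquiv

lemma scaledL_apply (x : X N) : W.scaledL x = (2 * Real.pi)⁻¹ • W.L x := rfl

lemma sqrt_abs_det_scaledL :
    Real.sqrt |LinearMap.det (W.scaledL : X N →ₗ[ℝ] X N)| =
      Real.sqrt ((2 * Real.pi)⁻¹ ^ N) * Real.sqrt |LinearMap.det W.L| := by
  have h : (W.scaledL : X N →ₗ[ℝ] X N) = (2 * Real.pi)⁻¹ • W.L := rfl
  rw [h, LinearMap.det_smul, abs_mul, Real.sqrt_mul (abs_nonneg _), abs_of_nonneg (by positivity)]
  simp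

/-- The factors `iᵐ` and `i^{-N/2}` are phases. -/
lemma norm_prefactor :
    ‖(1 / (2 * Real.pi * Complex.I)) ^ ((N : ℂ) / 2) * Complex.I ^ W.m‖ =
      Real.sqrt ((2 * Real.pi)⁻¹ ^ N) := by
  have h1 : ‖(1 / (2 * Real.pi * Complex.I))‖ = (2 * Real.pi)⁻¹ := by
    simp [abs_of_pos Real.pi_pos]
  have h2 : ((N : ℂ) / 2) = (((N : ℝ) / 2 : ℝ) : ℂ) := by push_cast; rfl
  have h3 : (1 / (2 * Real.pi * Complex.I)) ≠ 0 := by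
    rw [← norm_ne_zero_iff, h1]; positivity
  rw [norm_mul, norm_zpow, Complex.norm_I, one_zpow, mul_one, Complex.norm_cpow_of_ne_zero h3, h1,
    h2, Complex.ofReal_re, Complex.ofReal_im, mul_zero, Real.exp_zero, div_one,
    Real.sqrt_eq_rpow, ← Real.rpow_natCast, ← Real.rpow_mul (by positivity)]
  congr 1
  ring

/-- The integral operator with kernel `e^{iW(x, x')}`, in terms of the Fourier transform. -/
lemma integral_kernel (f : 𝓢(X N, ℂ)) (x : X N) :
    ∫ x' : X N, Complex.exp (Complex.I * (W.toFun x x' : ℝ)) * f x' =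
      chirpFun W.P x * 𝓕 (chirp W.Q f) (W.scaledL x) := by
  rw [SchwartzMap.fourier_coe, Real.fourier_eq', ← integral_const_mul]
  congr 1
  ext x'
  rw [chirp_apply, smul_eq_mul, ← mul_assoc, ← mul_assoc, chirpFun, chirpFun,
    ← Complex.exp_add, ← Complex.exp_add]
  congr 2
  have hpi : (Real.pi : ℂ) ≠ 0 := by exact_mod_cast Real.pi_ne_zero
  rw [scaledL_apply, real_inner_smul_right, toFun, real_inner_comm (W.L x) x']
  push_cast
  field_simp
  ring

/-- A quadratic Fourier transform is, up to a phase, the product of a chirp, a dilation, the Fourier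
transform and another chirp; the free symplectic map of its generating function factorizes
accordingly. -/
lemma isWignerCovariant {S : 𝓢(X N, ℂ) ≃L[ℂ] 𝓢(X N, ℂ)} {s : Sp N}
    (hS : W.IsQuadraticFourier S) (hs : W.Generates s) : IsWignerCovariant S s := by
  have h := (isWignerCovariant_chirp W.P W.isSymmetric_P).mul
    ((isWignerCovariant_dilation W.scaledL).mul ((isWignerCovariant_fourier N).mul
      (isWignerCovariant_chirp W.Q W.isSymmetric_Q)))
  have e : s = chirpSp W.P W.isSymmetric_P * (dilationSp W.scaledL * (fourierSp N *
      chirpSp W.Q W.isSymmetric_Q)) := by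
    refine Subtype.ext (ContinuousLinearEquiv.ext (funext fun z ↦ ?_))
    obtain ⟨x', ξ'⟩ := z
    refine ((hs _ _ x' ξ').2 ⟨?_, ?_⟩).symm
    · change ContinuousLinearMap.adjoint (W.scaledL : X N →L[ℝ] X N) (-((2 * Real.pi) • x')) +
        W.P (W.scaledL.symm ((2 * Real.pi)⁻¹ • (ξ' + W.Q x'))) =
        W.P (W.scaledL.symm ((2 * Real.pi)⁻¹ • (ξ' + W.Q x'))) - LinearMap.adjoint W.L x'
      rw [add_comm, sub_eq_add_neg]
      congr 1
      refine ext_inner_right ℝ fun v ↦ ?_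
      rw [ContinuousLinearMap.adjoint_inner_left, inner_neg_left, inner_neg_left,
        LinearMap.adjoint_inner_left, ContinuousLinearEquiv.coe_coe, scaledL_apply,
        real_inner_smul_left, real_inner_smul_right, mul_inv_cancel_left₀ (by positivity)]
    · change ξ' = W.L (W.scaledL.symm ((2 * Real.pi)⁻¹ • (ξ' + W.Q x'))) - W.Q x'
      have h1 := W.scaledL.apply_symm_apply ((2 * Real.pi)⁻¹ • (ξ' + W.Q x'))
      rw [scaledL_apply] at h1
      rw [smul_right_injective _ (inv_ne_zero (by positivity : (2 * Real.pi) ≠ 0)) h1,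
        add_sub_cancel_right]
  rw [e]
  have h0 : (Real.sqrt ((2 * Real.pi)⁻¹ ^ N) : ℂ) ≠ 0 :=
    Complex.ofReal_ne_zero.2 (Real.sqrt_ne_zero'.2 (by positivity))
  refine IsWignerCovariant.of_phase (c := (1 / (2 * Real.pi * Complex.I)) ^ ((N : ℂ) / 2) *
    Complex.I ^ W.m / (Real.sqrt ((2 * Real.pi)⁻¹ ^ N) : ℝ)) ?_ h fun f x ↦ ?_
  · rw [norm_div, norm_prefactor, Complex.norm_real, Real.norm_of_nonneg (Real.sqrt_nonneg _),
      div_self (Complex.ofReal_ne_zero.1 h0)]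
  · rw [hS f x, integral_kernel]
    change _ = _ * chirp W.P (dilation W.scaledL (𝓕 (chirp W.Q f))) x
    rw [chirp_apply, dilation_apply, sqrt_abs_det_scaledL]
    push_cast at h0 ⊢
    field_simp

end GeneratingFunction

lemma IsMetaplectic.isWignerCovariant {N : ℕ} {S : 𝓢(X N, ℂ) ≃L[ℂ] 𝓢(X N, ℂ)} {s : Sp N}
    (h : IsMetaplectic S s) : IsWignerCovariant S s := by
  refine Subgroup.closure_induction
    (p := fun p _ ↦ IsWignerCovariant p.1 p.2) ?_ .one (fun _ _ _ _ ↦ .mul) (fun _ _ ↦ .inv) h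
  rintro p ⟨W, hS, hs⟩
  exact W.isWignerCovariant hS hs

/-! ### Every symplectic map is covered by a covariant operator -/

/-- The subgroup of the symplectic maps `s` for which there is an operator that is covariant with
respect to `s`. Such `s` are called covered. -/
def coveredSp (N : ℕ) : Subgroup (Sp N) where
  carrier := {s | ∃ S, IsWignerCovariant S s}
  mul_mem' := fun ⟨S, hS⟩ ⟨T, hT⟩ ↦ ⟨S * T, hS.mul hT⟩
  one_mem' := ⟨1, .one⟩
  inv_mem' := fun ⟨S, hS⟩ ↦ ⟨S⁻¹, hS.inv⟩

variable {N : ℕ}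

lemma chirpSp_mem (P : X N →ₗ[ℝ] X N) (hP : P.IsSymmetric) : chirpSp P hP ∈ coveredSp N :=
  ⟨_, isWignerCovariant_chirp P hP⟩

lemma dilationSp_mem (L : X N ≃L[ℝ] X N) : dilationSp L ∈ coveredSp N :=
  ⟨_, isWignerCovariant_dilation L⟩

lemma fourierSp_mem : fourierSp N ∈ coveredSp N := ⟨_, isWignerCovariant_fourier N⟩

/-- A symplectic map that fixes the vertical Lagrangian plane pointwise is a shear. -/
lemma mem_coveredSp_of_fix (s : Sp N) (hs : ∀ p : X N, s.1 (0, p) = (0, p)) :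
    s ∈ coveredSp N := by
  have h1 : ∀ x : X N, (s.1 (x, 0)).1 = x := fun x ↦ by
    refine ext_inner_left ℝ fun p ↦ ?_
    have h := s.2 (0, p) (x, 0)
    rw [hs] at h
    simpa [symplecticForm] using h
  let C : X N →ₗ[ℝ] X N :=
    LinearMap.snd ℝ _ _ ∘ₗ (s.1 : (X N × X N) →ₗ[ℝ] X N × X N) ∘ₗ LinearMap.inl ℝ _ _
  have h2 : ∀ x : X N, s.1 (x, 0) = (x, C x) := fun x ↦ Prod.ext (h1 x) rfl
  have hC : C.IsSymmetric := fun x y ↦ by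
    have h := s.2 (x, 0) (y, 0)
    rw [h2, h2] at h
    simp only [symplecticForm, inner_zero_left, sub_zero] at h
    rw [real_inner_comm (C y) x]
    linarith
  have e : s = chirpSp C hC := by
    refine Subtype.ext (ContinuousLinearEquiv.ext (funext fun z ↦ ?_))
    have hz : z = (z.1, 0) + (0, z.2) := by simp
    rw [chirpSp_apply]
    conv_lhs => rw [hz, map_add, h2, hs]
    simp [add_comm]
  rw [e]
  exact chirpSp_mem C hC

/-- A symplectic map that preserves the vertical Lagrangian plane is covered. -/
lemma mem_coveredSp_of_vertical (s : Sp N) (D : X N ≃L[ℝ] X N)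
    (hs : ∀ p : X N, s.1 (0, p) = (0, D p)) : s ∈ coveredSp N := by
  -- The dilation by `L = (Dᵀ)⁻¹` acts on frequencies as `Lᵀ = D⁻¹`.
  let L : X N ≃L[ℝ] X N := adjointEquiv D.symm
  have hL : ∀ p, ContinuousLinearMap.adjoint (L : X N →L[ℝ] X N) (D p) = p := fun p ↦
    ext_inner_right ℝ fun v ↦ by
      rw [ContinuousLinearMap.adjoint_inner_left]
      change inner ℝ (D p) (ContinuousLinearMap.adjoint (D.symm : X N →L[ℝ] X N) v) = _
      rw [ContinuousLinearMap.adjoint_inner_right]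
      simp
  have h := mem_coveredSp_of_fix (dilationSp L * s) fun p ↦ by
    change (dilationSp L).1 (s.1 (0, p)) = _
    rw [hs, dilationSp_apply, hL]
    simp
  exact ((coveredSp N).mul_mem_cancel_left (dilationSp_mem L)).1 h

/-- A free symplectic map is covered: a shear moves the image of the vertical plane to the
horizontal one, and the Fourier transform moves it back to the vertical plane. -/
lemma mem_coveredSp_of_free (s : Sp N) (B : X N ≃L[ℝ] X N)
    (hs : ∀ p : X N, (s.1 (0, p)).1 = B p) : s ∈ coveredSp N := by
  let D : X N →ₗ[ℝ] X N :=
    LinearMap.snd ℝ _ _ ∘ₗ (s.1 : (X N × X N) →ₗ[ℝ] X N × X N) ∘ₗ LinearMap.inr ℝ _ _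
  have hD : ∀ p : X N, s.1 (0, p) = (B p, D p) := fun p ↦ Prod.ext (hs p) rfl
  have hBD : ∀ p q : X N, inner ℝ (D p) (B q) = inner ℝ (D q) (B p) := fun p q ↦ by
    have h := s.2 (0, p) (0, q)
    rw [hD, hD] at h
    simp only [symplecticForm, inner_zero_right, sub_zero] at h
    linarith
  -- The shear by `-D B⁻¹` moves `(Bp, Dp)` to `(Bp, 0)`; its matrix is symmetric because the
  -- image of the vertical plane under `s` is Lagrangian.
  let P : X N →ₗ[ℝ] X N := -(D ∘ₗ (B.symm : X N →ₗ[ℝ] X N))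
  have hPB : ∀ p, P (B p) = -D p := fun p ↦ by simp [P]
  have hP : P.IsSymmetric := fun x y ↦ by
    obtain ⟨p, rfl⟩ := B.surjective x
    obtain ⟨q, rfl⟩ := B.surjective y
    rw [hPB, hPB, inner_neg_left, inner_neg_right, hBD, real_inner_comm]
  have hpi : (-(2 * Real.pi) : ℝ) ≠ 0 := neg_ne_zero.2 (by positivity)
  have h := mem_coveredSp_of_vertical (fourierSp N * (chirpSp P hP * s))
    (B.trans (ContinuousLinearEquiv.smulLeft (Units.mk0 _ hpi))) fun p ↦ by
      change (fourierSp N).1 ((chirpSp P hP).1 (s.1 (0, p))) = _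
      rw [hD, chirpSp_apply, fourierSp_apply, hPB]
      simp [Units.smul_def]
  exact ((coveredSp N).mul_mem_cancel_left (chirpSp_mem P hP)).1
    (((coveredSp N).mul_mem_cancel_left fourierSp_mem).1 h)

/-- The horizontal shear `(x, ξ) ↦ (x + tξ, ξ)` is conjugate, by the Fourier transform, to the
vertical shear with matrix `-(2π)²t`. -/
lemma exists_horizontal_shear (t : ℝ) :
    ∃ u ∈ coveredSp N, ∀ z : X N × X N, u.1 z = (z.1 + t • z.2, z.2) := by
  have hP : ((-(2 * Real.pi) ^ 2 * t) • (LinearMap.id : X N →ₗ[ℝ] X N)).IsSymmetric :=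
    fun x y ↦ by simp [real_inner_smul_left, real_inner_smul_right]
  refine ⟨(fourierSp N)⁻¹ * (chirpSp _ hP * fourierSp N),
    mul_mem (inv_mem fourierSp_mem) (mul_mem (chirpSp_mem _ hP) fourierSp_mem), fun z ↦ ?_⟩
  change (fourierSp N).1.symm ((chirpSp _ hP).1 ((fourierSp N).1 z)) = _
  rw [ContinuousLinearEquiv.symm_apply_eq, fourierSp_apply, fourierSp_apply, chirpSp_apply]
  refine Prod.ext rfl ?_
  simp only [LinearMap.smul_apply, LinearMap.id_apply, smul_add, smul_smul, neg_add]
  have : (-(2 * Real.pi) ^ 2 * t) * (2 * Real.pi)⁻¹ = -((2 * Real.pi) * t) := by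
    field_simp
  rw [this, neg_smul]

/-- The image `{(Bp, Dp)}` of the vertical plane under a symplectic map is transversal to the
vertical plane after a horizontal shear by a suitable multiple of the identity: vectors in the
kernels of `B + tD` for distinct `t` have mutually orthogonal nonzero images under `D`, so that
only finitely many `t` are bad. -/
lemma exists_injective_shear (s : Sp N) :
    ∃ t : ℝ, ∀ p : X N, (s.1 (0, p)).1 + t • (s.1 (0, p)).2 = 0 → p = 0 := by
  by_contra! h
  choose p hp hp0 using h
  -- If every `t ∈ ℝ` is bad, the vectors `D t` form an uncountable orthogonal family in `ℝᴺ`.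
  set D : ℝ → X N := fun t ↦ (s.1 (0, p t)).2 with hDdef
  have hB : ∀ t, (s.1 (0, p t)).1 = -(t • D t) := fun t ↦ eq_neg_of_add_eq_zero_left (hp t)
  have hD0 : ∀ t, D t ≠ 0 := fun t h0 ↦ hp0 t (by
    have h1 : s.1 (0, p t) = 0 := Prod.ext (by rw [hB, h0]; simp) h0
    simpa using (s.1.map_eq_zero_iff.1 h1))
  have horth : Pairwise fun a b ↦ inner ℝ (D a) (D b) = 0 := fun a b hab ↦ by
    have h := s.2 (0, p a) (0, p b)
    simp only [symplecticForm, inner_zero_right, sub_zero] at h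
    rw [hB, hB, inner_neg_right, inner_neg_right, real_inner_smul_right,
      real_inner_smul_right, real_inner_comm (D a)] at h
    have h2 : (a - b) * inner ℝ (D a) (D b) = 0 := by linear_combination h
    exact (mul_eq_zero.1 h2).resolve_left (sub_ne_zero.2 hab)
  have hli := linearIndependent_of_ne_zero_of_inner_eq_zero (𝕜 := ℝ) hD0 horth
  have := hli.finite
  exact Set.infinite_univ.not_finite (Set.toFinite (Set.univ : Set ℝ))

/-- Every symplectic map becomes free after composition with a suitable horizontal shear. -/
theorem exists_isWignerCovariant (s : Sp N) : ∃ S, IsWignerCovariant S s := by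
  obtain ⟨t, ht⟩ := exists_injective_shear s
  obtain ⟨u, hu, hut⟩ := exists_horizontal_shear (N := N) t
  let B : X N →ₗ[ℝ] X N :=
    LinearMap.fst ℝ _ _ ∘ₗ ((u * s).1 : (X N × X N) →ₗ[ℝ] X N × X N) ∘ₗ LinearMap.inr ℝ _ _
  have hB : ∀ p, B p = (s.1 (0, p)).1 + t • (s.1 (0, p)).2 := fun p ↦
    congrArg Prod.fst (hut (s.1 (0, p)))
  have hinj : Function.Injective B :=
    (injective_iff_map_eq_zero B).2 fun p hp ↦ ht p ((hB p).symm.trans hp)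
  exact ((coveredSp N).mul_mem_cancel_left hu).1 (mem_coveredSp_of_free (u * s)
    (LinearEquiv.ofInjectiveEndo B hinj).toContinuousLinearEquiv fun p ↦ rfl)

/-! ### The Wigner transform and the splitting `ℝⁿ⁺ᵏ = ℝⁿ × ℝᵏ` -/

variable {n k : ℕ}

/-- The splitting of `ℝⁿ⁺ᵏ` as an isometry onto the product with the Euclidean norm; `join` itself
is not isometric, since the product type carries the maximum norm. -/
def splitIsometry (n k : ℕ) : X (n + k) ≃ₗᵢ[ℝ] WithLp 2 (X n × X k) :=
  (LinearIsometryEquiv.piLpCongrLeft 2 ℝ ℝ finSumFinEquiv.symm).trans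
    (PiLp.sumPiLpEquivProdLpPiLp 2 _)

lemma measurePreserving_join_symm (n k : ℕ) :
    MeasurePreserving (join n k).symm (volume : Measure (X (n + k)))
      (volume : Measure (X n × X k)) :=
  (WithLp.volume_preserving_ofLp (X n) (X k)).comp (splitIsometry n k).measurePreserving

lemma integral_join (f : X (n + k) → ℂ) : ∫ w, f w = ∫ p : X n × X k, f (join n k p) := by
  have h := (measurePreserving_join_symm n k).integral_comp
    (join n k).symm.toHomeomorph.measurableEmbedding (fun p ↦ f (join n k p))
  rw [← h]
  simp

lemma inner_join (p q : X n × X k) :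
    inner ℝ (join n k p) (join n k q) = inner ℝ p.1 q.1 + inner ℝ p.2 q.2 := by
  have h : ∀ p : X n × X k, join n k p = (splitIsometry n k).symm (WithLp.toLp 2 p) :=
    fun _ ↦ rfl
  rw [h, h, (splitIsometry n k).symm.inner_map_map, WithLp.prod_inner_apply]

/-- The value of a Schwartz function at the origin is the integral of its Fourier transform. -/
lemma integral_fourier_smul {m : ℕ} (H : 𝓢(X m, ℂ)) :
    ∫ η : X m, 𝓕 H ((2 * Real.pi)⁻¹ • η) = (2 * Real.pi : ℂ) ^ m * H 0 := by
  have h := Measure.integral_comp_smul (volume : Measure (X m)) (fun η ↦ 𝓕 H η)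
    ((2 * Real.pi)⁻¹)
  have h2 : 𝓕⁻ (𝓕 H) 0 = ∫ η, 𝓕 H η := by
    rw [SchwartzMap.fourierInv_coe, Real.fourierInv_eq']
    simp
  rw [FourierTransform.fourierInv_fourier_eq] at h2
  rw [h, h2, inv_pow, inv_inv, finrank_euclideanSpace_fin, abs_of_nonneg (by positivity),
    Complex.real_smul]
  push_cast
  rfl

/-- Integrating the Wigner transform on `ℝ²⁽ⁿ⁺ᵏ⁾` over the frequencies `η ∈ ℝᵏ` restricts the
integrand to the diagonal in `ℝᵏ`, by Fourier inversion. -/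
lemma integral_wigner_join (Ψ Φ : 𝓢(X (n + k), ℂ)) (x ξ : X n) (y : X k) :
    ∫ η : X k, wigner Ψ Φ (join n k (x, y), join n k (ξ, η)) =
      (1 / (2 * Real.pi : ℂ)) ^ n * ∫ x' : X n, Complex.exp (-(Complex.I * (inner ℝ ξ x' : ℝ))) *
        (Ψ (join n k (x + (1 / 2 : ℝ) • x', y)) * Φ (join n k (x - (1 / 2 : ℝ) • x', y))) := by
  -- `G(y', x')` is the integrand of the Wigner transform at `(x, y)`, without its exponential, and
  -- `H(y') = ∫ e^{-i ξ·x'} G(y', x') dx'`.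
  let G : 𝓢(X k × X n, ℂ) := SchwartzMap.compCLMOfContinuousLinearEquiv ℂ
    ((ContinuousLinearEquiv.prodComm ℝ (X k) (X n)).trans (join n k))
    (slice (join n k (x, y)) (SchwartzMap.compCLMOfContinuousLinearEquiv ℂ
      (midpointEquiv (n + k)) (tensorRight Φ Ψ)))
  have hG : ∀ y' x', G (y', x') = Ψ (join n k (x, y) + (1 / 2 : ℝ) • join n k (x', y')) *
      Φ (join n k (x, y) - (1 / 2 : ℝ) • join n k (x', y')) := fun _ _ ↦ rfl
  let H : 𝓢(X k, ℂ) := slice ξ (SchwartzMap.compCLMOfContinuousLinearEquiv ℂ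
    (ContinuousLinearEquiv.prodComm ℝ (X n) (X k)) (partialFourier G))
  have hH : ∀ y', H y' = ∫ x' : X n, Complex.exp (-(Complex.I * (inner ℝ ξ x' : ℝ))) *
      G (y', x') := fun _ ↦ rfl
  have hW : ∀ η : X k, wigner Ψ Φ (join n k (x, y), join n k (ξ, η)) =
      (1 / (2 * Real.pi : ℂ)) ^ (n + k) * 𝓕 H ((2 * Real.pi)⁻¹ • η) := fun η ↦ by
    have h1 := partialFourierFun_eq (E := X n) (F := X k)
      (SchwartzMap.compCLMOfContinuousLinearEquiv ℂ
        (ContinuousLinearEquiv.prodComm ℝ (X n) (X k)) (partialFourier G)) (ξ, η)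
    rw [wigner_apply, ← h1, integral_join, Measure.volume_eq_prod, integral_prod_symm]
    · congr 2
      ext y'
      change _ = _ • H y'
      rw [hH, smul_eq_mul, ← integral_const_mul]
      congr 1
      ext x'
      rw [hG, inner_join, ← mul_assoc (Complex.exp (-(Complex.I * (inner ℝ η y' : ℝ)))),
        ← Complex.exp_add]
      congr 2
      push_cast
      ring
    · have : ((volume : Measure (X k)).prod (volume : Measure (X n))).IsAddHaarMeasure :=
        inferInstance
      have hi := (G.integrable (μ := (volume : Measure (X k)).prod (volume : Measure (X n)))).swap
      refine hi.norm.mono' (Continuous.aestronglyMeasurable ?_)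
        (Filter.Eventually.of_forall fun p ↦ ?_)
      · have := Ψ.continuous
        have := Φ.continuous
        fun_prop
      · rw [norm_mul, Complex.norm_exp]
        simp only [Function.comp_apply, Prod.swap, hG]
        simp
  simp only [hW]
  rw [integral_const_mul, integral_fourier_smul, hH, ← mul_assoc, pow_add, mul_assoc (_ ^ n),
    ← mul_pow, one_div_mul_cancel (by simp [Real.pi_ne_zero]), one_pow, mul_one]
  congr 2
  ext x'
  rw [hG, ← map_smul, ← map_add, ← map_sub]
  simp

/-- The marginal of the Wigner transform that is dual to the symplectic extension of symbols. -/
lemma symbolRestriction_wigner {S : 𝓢(X (n + k), ℂ) ≃L[ℂ] 𝓢(X (n + k), ℂ)} {s : Sp (n + k)}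
    (hS : IsWignerCovariant S s) (Ψ Φ : 𝓢(X (n + k), ℂ)) (x ξ : X n) :
    symbolRestriction s (wigner Ψ (conjS Φ)) (x, ξ) =
      (1 / (2 * Real.pi : ℂ)) ^ n * ∫ y : X k, ∫ x' : X n,
        Complex.exp (-(Complex.I * (inner ℝ ξ x' : ℝ))) *
        (S Ψ (join n k (x + (1 / 2 : ℝ) • x', y)) *
          starRingEnd ℂ (S Φ (join n k (x - (1 / 2 : ℝ) • x', y)))) := by
  rw [symbolRestriction_apply, ← integral_const_mul]
  congr 1
  ext y
  refine Eq.trans ?_ (integral_wigner_join (S Ψ) (conjS (S Φ)) x ξ y)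
  congr 1
  ext η
  rw [← hS.wigner_map, s.1.apply_symm_apply]

lemma integral_integral_swap_of_bounded {g : X n → ℂ} (hg : Integrable g) (χ : 𝓢(X k, ℂ))
    {F : X k × X n → ℂ} (hF : Continuous F) {C : ℝ} (hC : ∀ p, ‖F p‖ ≤ C) :
    ∫ y : X k, ∫ x : X n, g x * (χ y * F (y, x)) = ∫ x : X n, g x * ∫ y : X k, χ y * F (y, x) := by
  rw [integral_integral_swap]
  · simp only [integral_const_mul]
  · have h := ((χ.integrable (μ := volume)).mul_prod hg).mul_bdd
      (c := C) hF.aestronglyMeasurable (Filter.Eventually.of_forall hC)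
    refine h.congr (Filter.Eventually.of_forall fun p ↦ ?_)
    simp only [Function.uncurry]
    ring

lemma integrable_exp_mul {g : X n → ℂ} (hg : Integrable g) (ξ : X n) :
    Integrable fun x ↦ Complex.exp (-(Complex.I * (inner ℝ ξ x : ℝ))) * g x := by
  refine hg.bdd_mul (c := 1) (Continuous.aestronglyMeasurable (by fun_prop))
    (Filter.Eventually.of_forall fun x ↦ ?_)
  rw [Complex.norm_exp]
  simp

lemma norm_le_schwartz {N : ℕ} (F : 𝓢(X N, ℂ)) (x : X N) :
    ‖F x‖ ≤ SchwartzMap.seminorm ℂ 0 0 F := SchwartzMap.norm_le_seminorm ℂ F x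

lemma apply_intertwiner (S : 𝓢(X (n + k), ℂ) ≃L[ℂ] 𝓢(X (n + k), ℂ)) (χ : 𝓢(X k, ℂ))
    (ψ : 𝓢(X n, ℂ)) (x : X n) (y : X k) :
    S (intertwiner S χ ψ) (join n k (x, y)) = ψ x * χ y := by
  rw [intertwiner, S.apply_symm_apply]
  change tensorRight χ ψ ((join n k).symm (join n k (x, y))) = _
  rw [ContinuousLinearEquiv.symm_apply_apply, tensorRight_apply]

/-- The duality between symbol restriction and the intertwiner in the first argument of the Wigner
transform. -/
lemma symbolRestriction_wigner_intertwiner {S : 𝓢(X (n + k), ℂ) ≃L[ℂ] 𝓢(X (n + k), ℂ)}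
    {s : Sp (n + k)} (hS : IsWignerCovariant S s) (χ : 𝓢(X k, ℂ)) (ψ : 𝓢(X n, ℂ))
    (Φ : 𝓢(X (n + k), ℂ)) :
    symbolRestriction s (wigner (intertwiner S χ ψ) (conjS Φ)) =
      wigner ψ (conjS (intertwinerAdjoint S χ Φ)) := by
  ext ⟨x, ξ⟩
  rw [symbolRestriction_wigner hS, wigner_apply]
  congr 1
  have hψ : Integrable fun x' : X n ↦ ψ (x + (1 / 2 : ℝ) • x') :=
    ((ψ.integrable (μ := volume)).comp_add_left x).comp_smul (by norm_num)
  have h := integral_integral_swap_of_bounded (integrable_exp_mul hψ ξ) χ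
    (F := fun p : X k × X n ↦ starRingEnd ℂ (S Φ (join n k (x - (1 / 2 : ℝ) • p.2, p.1))))
    (by have := (S Φ).continuous
        exact Complex.continuous_conj.comp (by fun_prop))
    (C := SchwartzMap.seminorm ℂ 0 0 (S Φ))
    (fun p ↦ by rw [RCLike.norm_conj]; exact norm_le_schwartz _ _)
  refine Eq.trans ?_ (h.trans ?_)
  · congr 1
    ext y
    congr 1
    ext x'
    rw [apply_intertwiner]
    ring
  · congr 1
    ext x'
    rw [conjS_apply, intertwinerAdjoint_apply, ← integral_conj, mul_assoc]
    simp

/-- The duality between symbol restriction and the intertwiner in the second argument of the Wigner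
transform. -/
lemma symbolRestriction_wigner_conjS_intertwiner {S : 𝓢(X (n + k), ℂ) ≃L[ℂ] 𝓢(X (n + k), ℂ)}
    {s : Sp (n + k)} (hS : IsWignerCovariant S s) (χ : 𝓢(X k, ℂ)) (φ : 𝓢(X n, ℂ))
    (Ψ : 𝓢(X (n + k), ℂ)) :
    symbolRestriction s (wigner Ψ (conjS (intertwiner S χ φ))) =
      wigner (intertwinerAdjoint S χ Ψ) (conjS φ) := by
  ext ⟨x, ξ⟩
  rw [symbolRestriction_wigner hS, wigner_apply]
  congr 1
  have hφ : Integrable fun x' : X n ↦ conjS φ (x - (1 / 2 : ℝ) • x') :=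
    (((conjS φ).integrable (μ := volume)).comp_sub_left x).comp_smul (by norm_num)
  have h := integral_integral_swap_of_bounded (integrable_exp_mul hφ ξ) (conjS χ)
    (F := fun p : X k × X n ↦ S Ψ (join n k (x + (1 / 2 : ℝ) • p.2, p.1)))
    (by have := (S Ψ).continuous
        fun_prop)
    (C := SchwartzMap.seminorm ℂ 0 0 (S Ψ)) (fun p ↦ norm_le_schwartz _ _)
  refine Eq.trans ?_ (h.trans ?_)
  · congr 1
    ext y
    congr 1
    ext x'
    rw [apply_intertwiner, map_mul, conjS_apply, conjS_apply]
    ring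
  · congr 1
    ext x'
    rw [intertwinerAdjoint_apply, mul_assoc, mul_comm (conjS φ _)]
    rfl

/-- `T*_{S,χ}` is the adjoint of `T_{S,χ}`. -/
lemma integral_intertwiner_mul_conj {S : 𝓢(X (n + k), ℂ) ≃L[ℂ] 𝓢(X (n + k), ℂ)}
    {s : Sp (n + k)} (hS : IsWignerCovariant S s) (χ : 𝓢(X k, ℂ)) (ψ : 𝓢(X n, ℂ))
    (Φ : 𝓢(X (n + k), ℂ)) :
    ∫ z, intertwiner S χ ψ z * starRingEnd ℂ (Φ z) =
      ∫ x, ψ x * starRingEnd ℂ (intertwinerAdjoint S χ Φ x) := by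
  have hc := (S Φ).continuous
  rw [← hS.integral_mul_conj, integral_join, Measure.volume_eq_prod, integral_prod_symm]
  · have h := integral_integral_swap_of_bounded (ψ.integrable (μ := volume)) χ
      (F := fun p : X k × X n ↦ starRingEnd ℂ (S Φ (join n k (p.2, p.1))))
      (Complex.continuous_conj.comp (by fun_prop)) (C := SchwartzMap.seminorm ℂ 0 0 (S Φ))
      (fun p ↦ by rw [RCLike.norm_conj]; exact norm_le_schwartz _ _)
    refine Eq.trans ?_ (h.trans ?_)
    · congr 1
      ext y
      congr 1
      ext x'
      rw [apply_intertwiner]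
      ring
    · congr 1
      ext x'
      rw [intertwinerAdjoint_apply, ← integral_conj]
      simp
  · have h := ((ψ.integrable (μ := volume)).mul_prod (χ.integrable (μ := volume))).mul_bdd
      (g := fun p : X n × X k ↦ starRingEnd ℂ (S Φ (join n k p)))
      (c := SchwartzMap.seminorm ℂ 0 0 (S Φ))
      (Complex.continuous_conj.comp (by fun_prop)).aestronglyMeasurable
      (Filter.Eventually.of_forall fun p ↦ by rw [RCLike.norm_conj]; exact norm_le_schwartz _ _)
    refine h.congr (Filter.Eventually.of_forall fun p ↦ ?_)
    obtain ⟨x, y⟩ := p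
    simp only [apply_intertwiner]

lemma conj_integral_comm {N : ℕ} (f g : 𝓢(X N, ℂ)) :
    ∫ x, f x * starRingEnd ℂ (g x) = starRingEnd ℂ (∫ x, g x * starRingEnd ℂ (f x)) := by
  rw [← integral_conj]
  congr 1
  ext x
  simp [mul_comm]

/-! ### Eigenfunctions -/

/-- The eigenvalue equation in weak form, tested against conjugates of Schwartz functions. -/
lemma isEigenfunction_weylOp_iff {N : ℕ} (a : 𝓢'(X N × X N, ℂ)) (μ : ℂ) (ψ : 𝓢(X N, ℂ)) :
    IsEigenfunction (weylOp a) μ ψ ↔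
      ψ ≠ 0 ∧ ∀ φ, a (wigner ψ (conjS φ)) = μ * ∫ x, ψ x * starRingEnd ℂ (φ x) := by
  refine and_congr_right fun _ ↦ ⟨fun h φ ↦ ?_, fun h ↦ ?_⟩
  · have h1 := congrArg (fun T : 𝓢'(X N, ℂ) ↦ T (conjS φ)) h
    simp only [weylOp_apply] at h1
    rw [h1]
    change μ * (SchwartzMap.toTemperedDistributionCLM (X N) ℂ volume ψ) (conjS φ) = _
    rw [SchwartzMap.toTemperedDistributionCLM_apply_apply volume]
    simp only [conjS_apply, smul_eq_mul, mul_comm]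
  · ext φ
    have h1 := h (conjS φ)
    rw [conjS_conjS] at h1
    rw [weylOp_apply, h1]
    change _ = μ * (SchwartzMap.toTemperedDistributionCLM (X N) ℂ volume ψ) φ
    rw [SchwartzMap.toTemperedDistributionCLM_apply_apply volume]
    simp only [conjS_apply, smul_eq_mul, Complex.conj_conj, mul_comm]

lemma intertwiner_ne_zero (S : 𝓢(X (n + k), ℂ) ≃L[ℂ] 𝓢(X (n + k), ℂ)) {χ : 𝓢(X k, ℂ)}
    (hχ : χ ≠ 0) {ψ : 𝓢(X n, ℂ)} (hψ : ψ ≠ 0) : intertwiner S χ ψ ≠ 0 := by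
  obtain ⟨x, hx⟩ := DFunLike.ne_iff.1 hψ
  obtain ⟨y, hy⟩ := DFunLike.ne_iff.1 hχ
  intro h
  have h1 := apply_intertwiner S χ ψ x y
  rw [h, map_zero] at h1
  exact mul_ne_zero hx hy h1.symm

lemma isEigenfunction_intertwiner {S : 𝓢(X (n + k), ℂ) ≃L[ℂ] 𝓢(X (n + k), ℂ)} {s : Sp (n + k)}
    (hS : IsWignerCovariant S s) {a : 𝓢'(X n × X n, ℂ)} {μ : ℂ} {ψ : 𝓢(X n, ℂ)}
    (h : IsEigenfunction (weylOp a) μ ψ) {χ : 𝓢(X k, ℂ)} (hχ : χ ≠ 0) :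
    IsEigenfunction (weylOp (extendSymbol s a)) μ (intertwiner S χ ψ) := by
  rw [isEigenfunction_weylOp_iff] at h ⊢
  refine ⟨intertwiner_ne_zero S hχ h.1, fun Φ ↦ ?_⟩
  rw [extendSymbol_apply, symbolRestriction_wigner_intertwiner hS, h.2,
    integral_intertwiner_mul_conj hS]

lemma isEigenfunction_intertwinerAdjoint {S : 𝓢(X (n + k), ℂ) ≃L[ℂ] 𝓢(X (n + k), ℂ)}
    {s : Sp (n + k)} (hS : IsWignerCovariant S s) {a : 𝓢'(X n × X n, ℂ)} {μ : ℂ}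
    {Ψ : 𝓢(X (n + k), ℂ)} (h : IsEigenfunction (weylOp (extendSymbol s a)) μ Ψ) {χ : 𝓢(X k, ℂ)}
    (hχ : intertwinerAdjoint S χ Ψ ≠ 0) :
    IsEigenfunction (weylOp a) μ (intertwinerAdjoint S χ Ψ) := by
  rw [isEigenfunction_weylOp_iff] at h ⊢
  refine ⟨hχ, fun φ ↦ ?_⟩
  rw [← symbolRestriction_wigner_conjS_intertwiner hS, ← extendSymbol_apply, h.2,
    conj_integral_comm, integral_intertwiner_mul_conj hS, ← conj_integral_comm]

/-- Every nonzero function is detected by some `T*_{S,χ}`: take for `χ` a nonzero slice of `SΨ`. -/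
lemma exists_intertwinerAdjoint_ne_zero (S : 𝓢(X (n + k), ℂ) ≃L[ℂ] 𝓢(X (n + k), ℂ))
    {Ψ : 𝓢(X (n + k), ℂ)} (hΨ : Ψ ≠ 0) : ∃ χ : 𝓢(X k, ℂ), intertwinerAdjoint S χ Ψ ≠ 0 := by
  obtain ⟨z, hz⟩ := DFunLike.ne_iff.1 ((map_ne_zero_iff S S.injective).2 hΨ)
  obtain ⟨⟨x, y⟩, rfl⟩ := (join n k).surjective z
  -- With `χ` the slice of `SΨ` at `x`, the value of `T*_{S,χ}Ψ` at `x` is `‖χ‖²`.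
  let χ : 𝓢(X k, ℂ) := slice x (SchwartzMap.compCLMOfContinuousLinearEquiv ℂ (join n k) (S Ψ))
  have hχ : ∀ y, χ y = S Ψ (join n k (x, y)) := fun _ ↦ rfl
  refine ⟨χ, fun h0 ↦ hz ?_⟩
  have h1 := intertwinerAdjoint_apply S χ Ψ x
  simp only [h0, ← hχ] at h1
  have h2 : inner ℂ (χ.toLp 2 volume) (χ.toLp 2 volume) = 0 := by
    rw [SchwartzMap.inner_toL2_toL2_eq χ χ volume]
    simp only [RCLike.inner_apply, mul_comm (χ _)]
    exact h1.symm
  have h3 : χ.toLp 2 volume = (0 : 𝓢(X k, ℂ)).toLp 2 volume := by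
    rw [inner_self_eq_zero.1 h2]
    exact ((SchwartzMap.toLpCLM ℂ ℂ 2 (volume : Measure (X k))).map_zero).symm
  rw [← hχ, SchwartzMap.injective_toLp 2 volume h3]
  rfl

lemma exists_schwartz_ne_zero (k : ℕ) : ∃ χ : 𝓢(X k, ℂ), χ ≠ 0 := by
  let f : ContDiffBump (0 : X k) := ⟨1, 2, one_pos, one_lt_two⟩
  have h1 : HasCompactSupport fun x ↦ (f x : ℂ) :=
    f.hasCompactSupport.comp_left (g := fun r : ℝ ↦ (r : ℂ)) Complex.ofReal_zero
  have h2 : ContDiff ℝ ∞ fun x ↦ (f x : ℂ) := Complex.ofRealCLM.contDiff.comp f.contDiff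
  refine ⟨h1.toSchwartzMap h2, DFunLike.ne_iff.2 ⟨0, ?_⟩⟩
  change (f 0 : ℂ) ≠ 0
  rw [f.one_of_mem_closedBall (Metric.mem_closedBall_self zero_le_one)]
  simp

lemma isEigenvalue_weylOp_extendSymbol_iff (s : Sp (n + k)) (a : 𝓢'(X n × X n, ℂ)) (μ : ℂ) :
    IsEigenvalue (weylOp a) μ ↔ IsEigenvalue (weylOp (extendSymbol s a)) μ := by
  obtain ⟨S, hS⟩ := exists_isWignerCovariant s
  constructor
  · rintro ⟨ψ, hψ⟩
    obtain ⟨χ, hχ⟩ := exists_schwartz_ne_zero k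
    exact ⟨_, isEigenfunction_intertwiner hS hψ hχ⟩
  · rintro ⟨Ψ, hΨ⟩
    obtain ⟨χ, hχ⟩ := exists_intertwinerAdjoint_ne_zero S hΨ.1
    exact ⟨_, isEigenfunction_intertwinerAdjoint hS hΨ hχ⟩

/-! ### Orthonormal bases -/

open scoped InnerProductSpace ENNReal

section Hilbert

variable {ι E : Type*} [NormedAddCommGroup E] [InnerProductSpace ℂ E]

lemma enorm_sq_eq_ofReal {F : Type*} [NormedAddCommGroup F] (x : F) :
    ‖x‖ₑ ^ 2 = ENNReal.ofReal (‖x‖ ^ 2) := by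
  rw [ENNReal.ofReal_pow (norm_nonneg _), ofReal_norm]

/-- Parseval's identity, as an identity in `[0, ∞]`. -/
lemma tsum_enorm_inner_sq (b : HilbertBasis ι ℂ E) (x : E) :
    ∑' i, ‖⟪b i, x⟫_ℂ‖ₑ ^ 2 = ‖x‖ₑ ^ 2 := by
  have h := Complex.hasSum_re (b.hasSum_inner_mul_inner x x)
  have e : ∀ i, (⟪x, b i⟫_ℂ * ⟪b i, x⟫_ℂ).re = ‖⟪b i, x⟫_ℂ‖ ^ 2 := fun i ↦ by
    rw [← inner_conj_symm x (b i), ← Complex.normSq_eq_conj_mul_self, Complex.ofReal_re,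
      Complex.normSq_eq_norm_sq]
  simp only [e] at h
  simp only [enorm_sq_eq_ofReal]
  rw [← ENNReal.ofReal_tsum_of_nonneg (fun _ ↦ by positivity) h.summable, h.tsum_eq]
  congr 1
  exact inner_self_eq_norm_sq (𝕜 := ℂ) x

/-- Bessel's inequality, as an inequality in `[0, ∞]`. -/
lemma Orthonormal.tsum_enorm_inner_sq_le {v : ι → E} (hv : Orthonormal ℂ v) (x : E) :
    ∑' i, ‖⟪v i, x⟫_ℂ‖ₑ ^ 2 ≤ ‖x‖ₑ ^ 2 := by
  simp only [enorm_sq_eq_ofReal]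
  rw [← ENNReal.ofReal_tsum_of_nonneg (fun _ ↦ by positivity) (hv.inner_products_summable x)]
  exact ENNReal.ofReal_le_ofReal (hv.tsum_inner_products_le x)

/-- A vector for which Parseval's identity holds lies in the closed span of the orthonormal
family. -/
lemma Orthonormal.mem_closure_span_of_parseval [CompleteSpace E] {v : ι → E}
    (hv : Orthonormal ℂ v) {x : E} (hx : ‖x‖ₑ ^ 2 ≤ ∑' i, ‖⟪v i, x⟫_ℂ‖ₑ ^ 2) :
    x ∈ (Submodule.span ℂ (Set.range v)).topologicalClosure := by
  set K := (Submodule.span ℂ (Set.range v)).topologicalClosure with hK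
  have : CompleteSpace K := (Submodule.isClosed_topologicalClosure _).completeSpace_coe
  obtain ⟨p, hp, q, hq, rfl⟩ := K.exists_add_mem_mem_orthogonal x
  have h1 : ∀ i, ⟪v i, p + q⟫_ℂ = ⟪v i, p⟫_ℂ := fun i ↦ by
    rw [inner_add_right, (K.mem_orthogonal q).1 hq (v i)
      (Submodule.le_topologicalClosure _ (Submodule.subset_span (Set.mem_range_self i))), add_zero]
  simp only [h1] at hx
  have h2 := hx.trans (Orthonormal.tsum_enorm_inner_sq_le hv p)
  rw [enorm_sq_eq_ofReal, enorm_sq_eq_ofReal, ENNReal.ofReal_le_ofReal_iff (by positivity)] at h2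
  have h3 := norm_add_sq_eq_norm_sq_add_norm_sq_of_inner_eq_zero p q
    ((K.mem_orthogonal q).1 hq p hp)
  have h4 : ‖q‖ = 0 := by nlinarith [norm_nonneg q]
  rw [norm_eq_zero.1 h4, add_zero]
  exact hp

/-- An orthonormal family in a separable space is countable, since the balls of radius `1/2` about
its members are disjoint. -/
lemma Orthonormal.countable_index [TopologicalSpace.SeparableSpace E] {v : ι → E}
    (hv : Orthonormal ℂ v) : Countable ι := by
  refine Pairwise.countable_of_isOpen_disjoint (s := fun i ↦ Metric.ball (v i) (1 / 2))
    (fun i j hij ↦ Metric.ball_disjoint_ball ?_) (fun i ↦ Metric.isOpen_ball)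
    (fun i ↦ ⟨v i, Metric.mem_ball_self (by norm_num)⟩)
  have h := norm_sub_sq (𝕜 := ℂ) (v i) (v j)
  rw [hv.1, hv.1, hv.2 hij, map_zero] at h
  rw [dist_eq_norm]
  nlinarith [norm_nonneg (v i - v j)]

end Hilbert

variable {n k : ℕ}

lemma inner_toLp {N : ℕ} (f g : 𝓢(X N, ℂ)) :
    ⟪f.toLp 2 volume, g.toLp 2 volume⟫_ℂ = ∫ x, g x * starRingEnd ℂ (f x) := by
  rw [SchwartzMap.inner_toL2_toL2_eq f g volume]
  simp only [RCLike.inner_apply]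

lemma enorm_toLp_sq {N : ℕ} (f : 𝓢(X N, ℂ)) :
    ‖f.toLp 2 volume‖ₑ ^ 2 = ∫⁻ x, ‖f x‖ₑ ^ 2 := by
  have h := eLpNorm_nnreal_pow_eq_lintegral (f := f) (μ := (volume : Measure (X N)))
    (p := 2) two_ne_zero
  have e : ‖f.toLp 2 volume‖ₑ = eLpNorm f 2 volume := Lp.enorm_toLp (f.memLp 2 volume)
  rw [e]
  simpa using h

namespace IsWignerCovariant

variable {S : 𝓢(X (n + k), ℂ) ≃L[ℂ] 𝓢(X (n + k), ℂ)} {s : Sp (n + k)}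

lemma inner_toLp_map (hS : IsWignerCovariant S s) (f g : 𝓢(X (n + k), ℂ)) :
    ⟪(S f).toLp 2 volume, (S g).toLp 2 volume⟫_ℂ = ⟪f.toLp 2 volume, g.toLp 2 volume⟫_ℂ := by
  rw [inner_toLp, inner_toLp, hS.integral_mul_conj]

lemma inner_intertwiner_intertwiner (hS : IsWignerCovariant S s) (χ χ' : 𝓢(X k, ℂ))
    (ψ ψ' : 𝓢(X n, ℂ)) :
    ⟪(intertwiner S χ ψ).toLp 2 volume, (intertwiner S χ' ψ').toLp 2 volume⟫_ℂ =
      ⟪ψ.toLp 2 volume, ψ'.toLp 2 volume⟫_ℂ * ⟪χ.toLp 2 volume, χ'.toLp 2 volume⟫_ℂ := by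
  rw [inner_toLp, inner_toLp, inner_toLp, ← hS.integral_mul_conj, integral_join,
    Measure.volume_eq_prod, ← integral_prod_mul]
  congr 1
  ext ⟨x, y⟩
  rw [apply_intertwiner, apply_intertwiner, map_mul]
  ring

lemma inner_intertwiner (hS : IsWignerCovariant S s) (χ : 𝓢(X k, ℂ)) (ψ : 𝓢(X n, ℂ))
    (Φ : 𝓢(X (n + k), ℂ)) :
    ⟪(intertwiner S χ ψ).toLp 2 volume, Φ.toLp 2 volume⟫_ℂ =
      ⟪ψ.toLp 2 volume, (intertwinerAdjoint S χ Φ).toLp 2 volume⟫_ℂ := by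
  rw [inner_toLp, inner_toLp, conj_integral_comm, integral_intertwiner_mul_conj hS,
    ← conj_integral_comm]

/-- Parseval's identity in the variables `y ∈ ℝᵏ`, integrated over `x ∈ ℝⁿ`. -/
lemma tsum_enorm_intertwinerAdjoint (hS : IsWignerCovariant S s) {κ : Type*}
    {χ : κ → 𝓢(X k, ℂ)} (hχ : IsOrthonormalBasis χ) (Φ : 𝓢(X (n + k), ℂ)) :
    ∑' l, ‖(intertwinerAdjoint S (χ l) Φ).toLp 2 volume‖ₑ ^ 2 = ‖Φ.toLp 2 volume‖ₑ ^ 2 := by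
  obtain ⟨c, hc⟩ := hχ
  have : Fact ((2 : ℝ≥0∞) ≠ ⊤) := ⟨ENNReal.ofNat_ne_top⟩
  have : Countable κ := Orthonormal.countable_index c.orthonormal
  simp only [enorm_toLp_sq (intertwinerAdjoint _ _ _)]
  rw [← lintegral_tsum fun l ↦
    ((intertwinerAdjoint S (χ l) Φ).continuous.enorm.measurable.pow_const 2).aemeasurable]
  -- The number `(T*_{S,χ_l}Φ)(x)` is the coefficient of the slice `f x = (SΦ)(x, ·)` at `χ_l`.
  let f : X n → 𝓢(X k, ℂ) := fun x ↦
    slice x (SchwartzMap.compCLMOfContinuousLinearEquiv ℂ (join n k) (S Φ))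
  have hf : ∀ x y, f x y = S Φ (join n k (x, y)) := fun _ _ ↦ rfl
  have h1 : ∀ x, ∑' l, ‖intertwinerAdjoint S (χ l) Φ x‖ₑ ^ 2 = ∫⁻ y, ‖f x y‖ₑ ^ 2 := fun x ↦ by
    rw [← enorm_toLp_sq, ← tsum_enorm_inner_sq c]
    congr 1
    ext l
    rw [hc, inner_toLp, intertwinerAdjoint_apply]
    simp only [hf, mul_comm]
  have h2 : ‖Φ.toLp 2 volume‖ₑ ^ 2 = ‖(S Φ).toLp 2 volume‖ₑ ^ 2 := by
    have h := congrArg RCLike.re (hS.inner_toLp_map Φ Φ)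
    rw [inner_self_eq_norm_sq, inner_self_eq_norm_sq] at h
    rw [enorm_sq_eq_ofReal, enorm_sq_eq_ofReal, h]
  have hmeas : Measurable fun p : X n × X k ↦ ‖S Φ (join n k p)‖ₑ ^ 2 := by
    have := (S Φ).continuous
    exact (this.comp (join n k).continuous).enorm.measurable.pow_const 2
  have h3 := (measurePreserving_join_symm n k).lintegral_comp hmeas
  simp only [ContinuousLinearEquiv.apply_symm_apply] at h3
  simp only [h1, hf]
  rw [h2, enorm_toLp_sq, h3, Measure.volume_eq_prod, lintegral_prod _ hmeas.aemeasurable]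

/-- Tensor products of orthonormal bases, transported by a unitary operator, form an orthonormal
basis: both Parseval identities combine to Parseval's identity on the dense subspace of Schwartz
functions. -/
lemma isOrthonormalBasis_intertwiner (hS : IsWignerCovariant S s) {ι κ : Type*}
    {ψ : ι → 𝓢(X n, ℂ)} {χ : κ → 𝓢(X k, ℂ)} (hψ : IsOrthonormalBasis ψ)
    (hχ : IsOrthonormalBasis χ) :
    IsOrthonormalBasis fun p : ι × κ ↦ intertwiner S (χ p.2) (ψ p.1) := by
  classical
  have hχ' := hχ
  obtain ⟨b, hb⟩ := hψ
  obtain ⟨c, hc⟩ := hχ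
  have hv : Orthonormal ℂ fun p : ι × κ ↦ (intertwiner S (χ p.2) (ψ p.1)).toLp 2 volume := by
    rw [orthonormal_iff_ite]
    rintro ⟨j, l⟩ ⟨j', l'⟩
    rw [hS.inner_intertwiner_intertwiner, ← hb, ← hb, ← hc, ← hc,
      orthonormal_iff_ite.1 b.orthonormal, orthonormal_iff_ite.1 c.orthonormal]
    simp only [Prod.mk.injEq, ite_and]
    split_ifs <;> simp
  refine ⟨HilbertBasis.mk hv ?_, fun p ↦ by rw [HilbertBasis.coe_mk]⟩
  have hclosed := Submodule.isClosed_topologicalClosure (Submodule.span ℂ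
    (Set.range fun p : ι × κ ↦ (intertwiner S (χ p.2) (ψ p.1)).toLp 2 volume))
  have hdense : DenseRange (SchwartzMap.toLpCLM ℂ ℂ 2 (volume : Measure (X (n + k)))) :=
    SchwartzMap.denseRange_toLpCLM ENNReal.ofNat_ne_top
  intro F _
  refine hdense.induction_on F hclosed fun Φ ↦ ?_
  refine Orthonormal.mem_closure_span_of_parseval hv (le_of_eq ?_)
  -- For fixed `l`, summation over `j` gives `‖T*_{S,χ_l}Φ‖²` by Parseval's identity in `ℝⁿ`.
  rw [ENNReal.tsum_prod', ENNReal.tsum_comm]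
  rw [SchwartzMap.toLpCLM_apply, ← hS.tsum_enorm_intertwinerAdjoint hχ' Φ]
  congr 1
  ext l
  rw [← tsum_enorm_inner_sq b]
  congr 1
  ext j
  rw [hS.inner_intertwiner, hb]

end IsWignerCovariant

end

end SymplecticExtension

theorem mainTheorem1 {n k : ℕ} (s : Sp (n + k))
    (A : 𝓢(X n, ℂ) →L[ℂ] 𝓢'(X n, ℂ)) (A' : 𝓢(X (n + k), ℂ) →L[ℂ] 𝓢'(X (n + k), ℂ))
    (hA' : IsSymplecticExtension s A A') :
    (∀ μ : ℂ, IsEigenvalue A μ ↔ IsEigenvalue A' μ) ∧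
    ∀ S : 𝓢(X (n + k), ℂ) ≃L[ℂ] 𝓢(X (n + k), ℂ), IsMetaplectic S s →
      (∀ (μ : ℂ) (ψ : 𝓢(X n, ℂ)), IsEigenfunction A μ ψ →
        ∀ χ : 𝓢(X k, ℂ), χ ≠ 0 → IsEigenfunction A' μ (intertwiner S χ ψ)) ∧
      (∀ (μ : ℂ) (Ψ : 𝓢(X (n + k), ℂ)), IsEigenfunction A' μ Ψ →
        ∀ χ : 𝓢(X k, ℂ), intertwinerAdjoint S χ Ψ ≠ 0 →
          IsEigenfunction A μ (intertwinerAdjoint S χ Ψ)) ∧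
      (∀ {ι κ : Type*} (μ : ι → ℂ) (ψ : ι → 𝓢(X n, ℂ)) (χ : κ → 𝓢(X k, ℂ)),
        IsOrthonormalBasis ψ → (∀ j, IsEigenfunction A (μ j) (ψ j)) → IsOrthonormalBasis χ →
          (∀ (j : ι) (l : κ), IsEigenfunction A' (μ j) (intertwiner S (χ l) (ψ j))) ∧
          IsOrthonormalBasis fun p : ι × κ ↦ intertwiner S (χ p.2) (ψ p.1)) := by
  obtain ⟨a, rfl, rfl⟩ := hA'
  refine ⟨isEigenvalue_weylOp_extendSymbol_iff s a, fun S hS ↦ ?_⟩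
  have hS := hS.isWignerCovariant
  refine ⟨fun μ ψ h χ hχ ↦ isEigenfunction_intertwiner hS h hχ,
    fun μ Ψ h χ hχ ↦ isEigenfunction_intertwinerAdjoint hS h hχ,
    fun μ ψ χ hψ h hχ ↦ ⟨fun j l ↦ isEigenfunction_intertwiner hS (h j) ?_,
      hS.isOrthonormalBasis_intertwiner hψ hχ⟩⟩
  -- An element of an orthonormal basis is nonzero.
  obtain ⟨c, hc⟩ := hχ
  intro h0
  refine c.orthonormal.ne_zero l ?_
  rw [hc, h0]
  exact (SchwartzMap.toLpCLM ℂ ℂ 2 (volume : Measure (X k))).map_zero
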